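/- Let $n,p,d$ be non-negative integers, $X$ an $n\times p$ real matrix with rows $x_i^T$, $y$ an $n\times d$ real matrix with rows $y_i^T$, $a\in\mathbb{R}$, and let $h:(0,\infty)\to[0,\infty)$ be a mixing density, i.e. a (Borel) probability density on $(0,\infty)$. Assume (S1) $\operatorname{rank}(X:y)=p+d$; (S2) $n>p+2d-2a$; (S3) $\int_0^\infty u^{d/2}h(u)\,du<\infty$; (S4) $\int_0^\infty u^{-\frac{n-p+2a-2d-1}{2}}h(u)\,du<\infty$. Let $\mathcal S_d\subset\mathbb{R}^{d(d+1)/2}$ be the set of $d\times d$ positive definite matrices, $\mathsf X=\mathbb{R}^{p\times d}\times\mathcal S_d$ with Lebesgue measure $d\beta\,d\Sigma$, and $r_i(\beta,\Sigma)=(\beta^Tx_i-y_i)^T\Sigma^{-1}(\beta^Tx_i-y_i)$. Put $$f(y|\beta,\Sigma)=\prod_{i=1}^n\int_0^\infty\frac{u^{d/2}}{(2\pi)^{d/2}|\Sigma|^{1/2}}e^{-\frac u2 r_i(\beta,\Sigma)}h(u)\,du,\qquad m(y)=\int_{\mathsf X}f(y|\beta,\Sigma)\,|\Sigma|^{-a}\,d\beta\,d\Sigma,$$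 and let $\pi(\beta,\Sigma|y)=f(y|\beta,\Sigma)|\Sigma|^{-a}/m(y)$ be the posterior density. For $s\ge0$ let $\psi(u;s)=b(s)u^{d/2}e^{-su/2}h(u)$, where $b(s)$ is the constant making this a probability density in $u>0$. For $z\in(0,\infty)^n$ let $Q^{-1}=\operatorname{diag}(z_1,\dots,z_n)$, $\Omega=(X^TQ^{-1}X)^{-1}$, $\mu=\Omega X^TQ^{-1}y$. Let $\pi(z|\beta,\Sigma,y)=\prod_{i=1}^n\psi(z_i;r_i(\beta,\Sigma))$; let $\pi(\Sigma|z,y)$ be the density of the inverse Wishart distribution $\mathrm{IW}_d\big(n-p+2a-d-1,(y^TQ^{-1}y-\mu^T\Omega^{-1}\mu)^{-1}\big)$, and $\pi(\beta|\Sigma,z,y)$ that of the matrix normal distribution $\mathrm N_{p,d}(\mu,\Omega,\Sigma)$. Here $\mathrm{IW}_r(m,\Theta)$ has density proportional to $|w|^{-(m+r+1)/2}\exp\{-\frac12\operatorname{tr}(\Theta^{-1}w^{-1})\}$ on $\mathcal S_r$, and $\mathrm N_{r,c}(\theta,A,B)$ has density proportional to $\exp[-\frac12\operatorname{tr}\{A^{-1}(w-\theta)B^{-1}(w-\theta)^T\}]$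 on $\mathbb{R}^{r\times c}$. The data augmentation Markov chain on $\mathsf X$ has the transition density $$k\big((\beta',\Sigma')\,|\,(\beta,\Sigma)\big)=\int_{(0,\infty)^n}\pi(\beta'|\Sigma',z,y)\,\pi(\Sigma'|z,y)\,\pi(z|\beta,\Sigma,y)\,dz.$$ Suppose that $h$ is strictly positive in a neighborhood of the origin, and that there exist $\zeta\in(1,2)$ and $\eta>0$ such that $$\int_0^\eta\frac{u^{d/2}h(u)}{\int_0^{\zeta u}v^{d/2}h(v)\,dv}\,du<\infty .$$ Then the posterior is proper ($0<m(y)<\infty$, so $\pi(\cdot|y)$ is a probability density), and the formula $$(Kf)(\beta,\Sigma)=\int_{\mathsf X}f(\beta',\Sigma')\,k\big((\beta',\Sigma')\,|\,(\beta,\Sigma)\big)\,d\beta'\,d\Sigma'$$ defines a bounded, self-adjoint, positive operator $K$ on $L_0^2=\{f:\int f^2\,\pi\,d\beta\,d\Sigma<\infty,\ \int f\,\pi\,d\beta\,d\Sigma=0\}$ which is trace-class: $K$ is compact and its eigenvalues, counted with multiplicity, are summable. -/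

import Mathlib

open MeasureTheory Set
open scoped ENNReal NNReal

namespace DataAug

noncomputable section

/-- A mixing density: a probability density on `(0, ∞)` with values in `[0, ∞)`. Only the values
of `h` on `(0, ∞)` are used anywhere. -/
structure IsMixingDensity (h : ℝ → ℝ≥0) : Prop where
  measurable : Measurable h
  lintegral_eq_one : ∫⁻ u in Ioi (0 : ℝ), (h u : ℝ≥0∞) = 1

/-- Positions on or above the diagonal of a `d × d` matrix; there are `d (d + 1) / 2` of them. -/
abbrev SymIdx (d : ℕ) : Type := {ij : Fin d × Fin d // ij.1 ≤ ij.2}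

/-- The symmetric matrix with the given entries on and above the diagonal. -/
def symMat {d : ℕ} (s : SymIdx d → ℝ) : Matrix (Fin d) (Fin d) ℝ :=
  Matrix.of fun i j => s ⟨(min i j, max i j), min_le_max⟩

/-- Pairs `(β, Σ)` of a `p × d` matrix and a symmetric `d × d` matrix, in coordinates. The state
space `ℝ^{p × d} × S_d` is the subset on which `Σ` is positive definite, and
`stateMeasure` is Lebesgue measure `dβ dΣ` on that subset. -/
abbrev State (p d : ℕ) : Type := (Fin p → Fin d → ℝ) × (SymIdx d → ℝ)

/-- The regression matrix `β`. -/
def State.beta {p d : ℕ} (s : State p d) : Matrix (Fin p) (Fin d) ℝ := Matrix.of s.1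

/-- The scale matrix `Σ`. -/
def State.scale {p d : ℕ} (s : State p d) : Matrix (Fin d) (Fin d) ℝ := symMat s.2

/-- The measure `dβ dΣ` on `ℝ^{p × d} × S_d`. -/
def stateMeasure (p d : ℕ) : Measure (State p d) :=
  (volume : Measure (State p d)).restrict {s | s.scale.PosDef}

section Model

variable {n p d : ℕ} (h : ℝ → ℝ≥0) (a : ℝ)
  (X : Matrix (Fin n) (Fin p) ℝ) (y : Matrix (Fin n) (Fin d) ℝ)

/-- `(βᵀ xᵢ - yᵢ)ᵀ Σ⁻¹ (βᵀ xᵢ - yᵢ)`. -/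
def resid (s : State p d) (i : Fin n) : ℝ :=
  (s.beta.transpose.mulVec (X i) - y i) ⬝ᵥ
    (s.scale⁻¹.mulVec (s.beta.transpose.mulVec (X i) - y i))

/-- The joint density `f(y | β, Σ)` of the data. -/
def likelihood (s : State p d) : ℝ≥0∞ :=
  ∏ i : Fin n, ∫⁻ u in Ioi (0 : ℝ),
    ENNReal.ofReal (u ^ ((d : ℝ) / 2) / ((2 * Real.pi) ^ ((d : ℝ) / 2) * s.scale.det ^ (1 / 2 : ℝ))
      * Real.exp (-(u / 2) * resid X y s i)) * (h u : ℝ≥0∞)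

/-- The improper prior `|Σ|^{-a}`. -/
def prior (s : State p d) : ℝ≥0∞ := ENNReal.ofReal (s.scale.det ^ (-a))

/-- `m(y)`. -/
def marginal : ℝ≥0∞ := ∫⁻ s, likelihood h X y s * prior a s ∂stateMeasure p d

/-- The posterior density `π(β, Σ | y)`. -/
def posteriorDensity (s : State p d) : ℝ≥0∞ :=
  likelihood h X y s * prior a s / marginal h a X y

/-- The posterior distribution of `(β, Σ)`. -/
def posterior : Measure (State p d) :=
  (stateMeasure p d).withDensity (posteriorDensity h a X y)

/-- The density `ψ(u; s) = b(s) u^{d/2} e^{-su/2} h(u)`, with `b(s)` the normalizing constant. -/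
def psi (d : ℕ) (u s : ℝ) : ℝ≥0∞ :=
  ENNReal.ofReal (u ^ ((d : ℝ) / 2) * Real.exp (-(s * u) / 2)) * (h u : ℝ≥0∞) /
    ∫⁻ v in Ioi (0 : ℝ),
      ENNReal.ofReal (v ^ ((d : ℝ) / 2) * Real.exp (-(s * v) / 2)) * (h v : ℝ≥0∞)

/-- The density of the matrix normal distribution `N_{r,c}(θ, A, B)`. -/
def matrixNormalDensity {r c : ℕ} (θ : Matrix (Fin r) (Fin c) ℝ) (A : Matrix (Fin r) (Fin r) ℝ)
    (B : Matrix (Fin c) (Fin c) ℝ) (w : Matrix (Fin r) (Fin c) ℝ) : ℝ :=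
  1 / ((2 * Real.pi) ^ ((r * c : ℝ) / 2) * A.det ^ ((c : ℝ) / 2) * B.det ^ ((r : ℝ) / 2)) *
    Real.exp (-(1 / 2) * (A⁻¹ * (w - θ) * B⁻¹ * (w - θ).transpose).trace)

/-- The density of the inverse Wishart distribution `IW_r(m, Θ)` on positive definite matrices. -/
def invWishartDensity {r : ℕ} (m : ℝ) (Θ w : Matrix (Fin r) (Fin r) ℝ) : ℝ :=
  w.det ^ (-(m + r + 1) / 2) * Real.exp (-(1 / 2) * (Θ⁻¹ * w⁻¹).trace) /
    ((2 : ℝ) ^ (m * r / 2) * Real.pi ^ ((r : ℝ) * (r - 1) / 4) * Θ.det ^ (m / 2) *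
      ∏ i ∈ Finset.Icc 1 r, Real.Gamma ((m + 1 - i) / 2))

/-- `Ω = (Xᵀ Q⁻¹ X)⁻¹`, where `Q⁻¹` is the diagonal matrix with entries `zᵢ`. -/
def omegaMat (z : Fin n → ℝ) : Matrix (Fin p) (Fin p) ℝ :=
  (X.transpose * Matrix.diagonal z * X)⁻¹

/-- `μ = (Xᵀ Q⁻¹ X)⁻¹ Xᵀ Q⁻¹ y`. -/
def muMat (z : Fin n → ℝ) : Matrix (Fin p) (Fin d) ℝ :=
  omegaMat X z * X.transpose * Matrix.diagonal z * y

/-- `yᵀ Q⁻¹ y - μᵀ Ω⁻¹ μ`. -/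
def residMat (z : Fin n → ℝ) : Matrix (Fin d) (Fin d) ℝ :=
  y.transpose * Matrix.diagonal z * y -
    (muMat X y z).transpose * (omegaMat X z)⁻¹ * muMat X y z

/-- `π(z | β, Σ, y)`: the `zᵢ` are independent with densities `ψ(· ; rᵢ(β, Σ))`. -/
def condLatent (z : Fin n → ℝ) (s : State p d) : ℝ≥0∞ :=
  ∏ i : Fin n, psi h d (z i) (resid X y s i)

/-- `π(Σ | z, y)`: inverse Wishart. -/
def condScale (s : State p d) (z : Fin n → ℝ) : ℝ≥0∞ :=
  ENNReal.ofReal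
    (invWishartDensity ((n : ℝ) - p + 2 * a - d - 1) (residMat X y z)⁻¹ s.scale)

/-- `π(β | Σ, z, y)`: matrix normal. -/
def condBeta (s : State p d) (z : Fin n → ℝ) : ℝ≥0∞ :=
  ENNReal.ofReal (matrixNormalDensity (muMat X y z) (omegaMat X z) s.scale s.beta)

/-- The Markov transition density `k(s' | s)` of the data augmentation chain. -/
def transDensity (s' s : State p d) : ℝ≥0∞ :=
  ∫⁻ z in {z : Fin n → ℝ | ∀ i, 0 < z i},
    condBeta X y s' z * condScale a X y s' z * condLatent h X y z s

end Model

/-- The space `L²₀(μ)` of square-integrable functions with mean zero. For a finite measure the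
integrability clause holds for every element of `L²`. -/
def L20 {α : Type*} [MeasurableSpace α] (μ : Measure α) : Submodule ℝ (Lp ℝ 2 μ) where
  carrier := {f | Integrable f μ ∧ ∫ t, f t ∂μ = 0}
  zero_mem' := by
    have h0 := Lp.coeFn_zero ℝ 2 μ
    exact ⟨(integrable_congr h0).2 (integrable_zero _ _ _), by rw [integral_congr_ae h0]; simp⟩
  add_mem' := by
    rintro f g ⟨hf, hf0⟩ ⟨hg, hg0⟩
    have h0 := Lp.coeFn_add f g
    refine ⟨(integrable_congr h0).2 (hf.add hg), ?_⟩
    rw [integral_congr_ae h0]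
    simp only [Pi.add_apply]
    rw [integral_add hf hg, hf0, hg0, add_zero]
  smul_mem' := by
    rintro c f ⟨hf, hf0⟩
    have h0 := Lp.coeFn_smul c f
    refine ⟨(integrable_congr h0).2 (hf.smul c), ?_⟩
    rw [integral_congr_ae h0]
    simp only [Pi.smul_apply]
    rw [integral_smul, hf0, smul_zero]

/-- `K` is the Markov operator `(K f)(s) = ∫ f(s') k(s' | s) ds'` of the data augmentation chain
on `L²₀` of the posterior. This determines `K`. -/
def IsMarkovOperator {n p d : ℕ} (h : ℝ → ℝ≥0) (a : ℝ)
    (X : Matrix (Fin n) (Fin p) ℝ) (y : Matrix (Fin n) (Fin d) ℝ)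
    (K : L20 (posterior h a X y) →L[ℝ] L20 (posterior h a X y)) : Prop :=
  ∀ f : L20 (posterior h a X y), ∀ᵐ s ∂posterior h a X y,
    Integrable (fun s' => (f : Lp ℝ 2 (posterior h a X y)) s' * (transDensity h a X y s' s).toReal)
        (stateMeasure p d) ∧
      (K f : Lp ℝ 2 (posterior h a X y)) s =
        ∫ s', (f : Lp ℝ 2 (posterior h a X y)) s' * (transDensity h a X y s' s).toReal
          ∂stateMeasure p d

/-- A positive self-adjoint operator is trace-class if it is compact and its eigenvalues, counted
with multiplicity, are summable. (The nonzero eigenvalues of a compact operator have finite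
multiplicity, and the eigenvalue `0` contributes nothing.) -/
structure IsPositiveTraceClass {E : Type*} [NormedAddCommGroup E] [InnerProductSpace ℝ E]
    (T : E →L[ℝ] E) : Prop where
  isPositive : T.IsPositive
  isCompact : IsCompactOperator T
  summable_eigenvalues : Summable fun μ : ℝ =>
    (Module.finrank ℝ (Module.End.eigenspace (T : E →ₗ[ℝ] E) μ) : ℝ) * |μ|

end

end DataAug

/-! Write s = (β, Σ), W(z) for `mixWeight`, J(z, s) for `jointWeight` with exponent t = n/2 + a, and
G(s) = ∫ W(z) J(z, s) dz for `jointMass`. The posterior density is G / I with I = ∫ G ds. Gaussian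
and inverse Wishart integration give ∫ J(z, s) ds = C N(z) with N = `normFactor`. The conditional
densities of β and Σ multiply to c J(z, s') / N(z), so k(s' | s) = ∫ c N(z)⁻¹ J(z, s') W(z) J(z, s)
/ G(s) dz.

Put κ(s, z) = J(z, s) / G(s) and dQ = (c I W / N) dz. Then k(s' | s) is the posterior density at s'
times ∫ κ(s', z) κ(s, z) dQ(z). Hence K = A* A, where A : L²(posterior) → L²(Q) has kernel κ. Such a
K is self-adjoint and positive, and it is trace-class once A is Hilbert–Schmidt, that is, once ∫ k(s
| s) ds < ∞ (`isPositiveTraceClass_of_factor`, `exists_positiveTraceClass_of_kernel`,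
`exists_dataAugmentation_operator`).

The trace is bounded in `lintegral_trace_lt_top`. The normalizing integral of ψ(u; r) is at least
exp(-rζu/2) times the mass of v^{d/2} h(v) on (0, ζu), so ψ(u; r) ≤ ρ(u) exp((ζ - 1)ur/2), where ρ
is the integrand of the hypothesis. Multiplied by the factor exp(-ur/2) of J this leaves exp(-(2 -
ζ)ur/2), still decaying because ζ < 2. The integral over s is therefore C N((2 - ζ)z), a constant
multiple of N(z) by homogeneity, and N(z)⁻¹ cancels it. What remains is a product of integrals of ρ,
finite near 0 by hypothesis and away from 0 by (S3).

Propriety (`lintegral_mixWeight_mul_lt_top`) asks for ∫ W(z) ∫ J(z, s) ds dz < ∞. Discarding all but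
p + d independent rows of (X : y) only increases the inner integral. For those rows the determinants
reduce to monomials in the weights, and every weight ends up with h(u) times u to the power 0, the
power of (S4), or d/2. -/

namespace DataAug

/-! ### Hilbert space theory: operators A* A with A Hilbert–Schmidt. -/

section HilbertSpace

variable {E F : Type*} [NormedAddCommGroup E] [InnerProductSpace ℝ E]
  [NormedAddCommGroup F] [InnerProductSpace ℝ F]

open scoped InnerProductSpace

/-- The hypothesis says T = A* A without mentioning an adjoint, so F need not be complete. Pair T x
with itself and apply Cauchy–Schwarz. -/
theorem norm_apply_le_of_factor (A : E →L[ℝ] F) (T : E →L[ℝ] E)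
    (hTA : ∀ x y, ⟪T x, y⟫_ℝ = ⟪A x, A y⟫_ℝ) (x : E) : ‖T x‖ ≤ ‖A‖ * ‖A x‖ := by
  have h1 : ‖T x‖ * ‖T x‖ ≤ (‖A‖ * ‖A x‖) * ‖T x‖ := by
    rw [← real_inner_self_eq_norm_mul_norm, hTA]
    calc ⟪A x, A (T x)⟫_ℝ ≤ ‖A x‖ * ‖A (T x)‖ := real_inner_le_norm _ _
      _ ≤ ‖A x‖ * (‖A‖ * ‖T x‖) := by gcongr; exact A.le_opNorm _
      _ = _ := by ring
  by_cases h0 : ‖T x‖ = 0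
  · rw [h0]; positivity
  · exact le_of_mul_le_mul_right h1 (lt_of_le_of_ne (norm_nonneg _) (Ne.symm h0))

theorem orthonormal_option {ι : Type*} {v : ι → E} (hv : Orthonormal ℝ v)
    {x : E} (hx : ‖x‖ = 1) (hvx : ∀ i, ⟪v i, x⟫_ℝ = 0) :
    Orthonormal ℝ (fun o : Option ι => o.elim x v) := by
  constructor
  · rintro (_ | i)
    · exact hx
    · exact hv.1 i
  · rintro (_ | i) (_ | j) hij
    · exact absurd rfl hij
    · simpa [real_inner_comm] using hvx j
    · exact hvx i
    · exact hv.2 (fun h => hij (by rw [h]))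

/-- An operator `T = A* A` for which the sums `∑ ‖A vᵢ‖²` over finite orthonormal families are
bounded can be approximated by operators of finite rank. -/
theorem isCompactOperator_of_factor [CompleteSpace E] (A : E →L[ℝ] F) (T : E →L[ℝ] E)
    (hTA : ∀ x y, ⟪T x, y⟫_ℝ = ⟪A x, A y⟫_ℝ) (M : ℝ)
    (hM : ∀ (ι : Type) [Fintype ι] (v : ι → E), Orthonormal ℝ v → ∑ i, ‖A (v i)‖ ^ 2 ≤ M) :
    IsCompactOperator T := by
  classical
  set V : Set ℝ := {t | ∃ (ι : Type) (_ : Fintype ι) (v : ι → E), Orthonormal ℝ v ∧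
    t = ∑ i, ‖A (v i)‖ ^ 2} with hV
  have hbdd : BddAbove V := by
    refine ⟨M, ?_⟩
    rintro t ⟨ι, _, v, hv, rfl⟩
    exact hM ι v hv
  have hne : V.Nonempty :=
    ⟨0, Empty, inferInstance, Empty.elim, ⟨fun i => i.elim, fun i => i.elim⟩, by simp⟩
  have key : T ∈ closure {S : E →L[ℝ] E | IsCompactOperator S} := by
    rw [Metric.mem_closure_iff]
    intro ε hε
    obtain ⟨δ, hδ, hδε⟩ : ∃ δ > 0, ‖A‖ * Real.sqrt δ < ε := by
      refine ⟨(ε / (2 * (‖A‖ + 1))) ^ 2, by positivity, ?_⟩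
      rw [Real.sqrt_sq (by positivity)]
      rw [mul_div_assoc', div_lt_iff₀ (by positivity)]
      nlinarith [norm_nonneg A]
    -- A finite orthonormal family within δ of the supremum: on the complement of its span A has
    -- norm at most √δ, since a further unit vector x raises the sum by ‖A x‖².
    obtain ⟨t, ⟨ι, _, v, hv, rfl⟩, ht⟩ := exists_lt_of_lt_csSup hne (sub_lt_self (sSup V) hδ)
    let U : Submodule ℝ E := Submodule.span ℝ (range v)
    have : FiniteDimensional ℝ U := FiniteDimensional.span_of_finite ℝ (finite_range v)
    have hperp : ∀ x ∈ Uᗮ, ‖A x‖ ≤ Real.sqrt δ * ‖x‖ := by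
      intro x hx
      by_cases hx0 : x = 0
      · simp [hx0]
      have hxn : 0 < ‖x‖ := norm_pos_iff.2 hx0
      have hu : ‖(‖x‖⁻¹ • x)‖ = 1 := by
        rw [norm_smul, norm_inv, norm_norm, inv_mul_cancel₀ hxn.ne']
      have ho : ∀ i, ⟪v i, ‖x‖⁻¹ • x⟫_ℝ = 0 := by
        intro i
        rw [inner_smul_right, hx (v i) (Submodule.subset_span (mem_range_self i)), mul_zero]
      have hle : ∑ o, ‖A ((fun o : Option ι => o.elim (‖x‖⁻¹ • x) v) o)‖ ^ 2 ≤ sSup V :=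
        le_csSup hbdd ⟨Option ι, inferInstance, _, orthonormal_option hv hu ho, rfl⟩
      rw [Fintype.sum_option] at hle
      simp only [Option.elim_none, Option.elim_some, map_smul, norm_smul, norm_inv,
        norm_norm] at hle
      have h2 : (‖x‖⁻¹ * ‖A x‖) ^ 2 ≤ δ := by linarith
      have h3 := Real.le_sqrt_of_sq_le h2
      rwa [inv_mul_le_iff₀ hxn, mul_comm] at h3
    -- The finite-rank approximant is T composed with the projection onto that span.
    refine ⟨T ∘L (U.subtypeL ∘L U.orthogonalProjectionOnto), ?_, ?_⟩
    · have := FiniteDimensional.proper ℝ U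
      have h1 : IsCompactOperator (U.orthogonalProjectionOnto : E →L[ℝ] U) :=
        (isCompactOperator_id (E := U)).comp_clm U.orthogonalProjectionOnto
      exact h1.clm_comp (T ∘L U.subtypeL)
    · rw [dist_eq_norm]
      refine lt_of_le_of_lt (ContinuousLinearMap.opNorm_le_bound _
        (mul_nonneg (norm_nonneg A) (Real.sqrt_nonneg δ)) fun x => ?_) hδε
      have hmem := U.sub_starProjection_mem_orthogonal x
      have heq : (T - T ∘L (U.subtypeL ∘L U.orthogonalProjectionOnto)) x
          = T (x - U.starProjection x) := by
        simp [map_sub]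
      rw [heq]
      calc ‖T (x - U.starProjection x)‖ ≤ ‖A‖ * ‖A (x - U.starProjection x)‖ :=
            norm_apply_le_of_factor A T hTA _
        _ ≤ ‖A‖ * (Real.sqrt δ * ‖x - U.starProjection x‖) := by
            gcongr; exact hperp _ hmem
        _ ≤ ‖A‖ * (Real.sqrt δ * ‖x‖) := by
            gcongr
            have := U.norm_sq_eq_add_norm_sq_starProjection x
            rw [Submodule.starProjection_orthogonal_val] at this
            have h5 : ‖x - U.starProjection x‖ ^ 2 ≤ ‖x‖ ^ 2 := by
              nlinarith [sq_nonneg ‖U.starProjection x‖]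
            exact (sq_le_sq₀ (norm_nonneg _) (norm_nonneg _)).1 h5
        _ = _ := by ring
  rwa [isClosed_setOfPred_isCompactOperator.closure_eq] at key

theorem summable_eigenvalues_of_factor (A : E →L[ℝ] F) (T : E →L[ℝ] E)
    (hTA : ∀ x y, ⟪T x, y⟫_ℝ = ⟪A x, A y⟫_ℝ) (M : ℝ)
    (hM : ∀ (ι : Type) [Fintype ι] (v : ι → E), Orthonormal ℝ v → ∑ i, ‖A (v i)‖ ^ 2 ≤ M) :
    Summable fun μ : ℝ =>
      (Module.finrank ℝ (Module.End.eigenspace (T : E →ₗ[ℝ] E) μ) : ℝ) * |μ| := by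
  classical
  have hsymm : (T : E →ₗ[ℝ] E).IsSymmetric := fun x y => by
    change ⟪T x, y⟫_ℝ = ⟪x, T y⟫_ℝ
    rw [hTA, real_inner_comm, ← hTA, real_inner_comm]
  have hfam := hsymm.orthogonalFamily_eigenspaces
  have hbas : ∀ μ : ℝ, ∃ w : Fin (Module.finrank ℝ (Module.End.eigenspace (T : E →ₗ[ℝ] E) μ)) →
      Module.End.eigenspace (T : E →ₗ[ℝ] E) μ, Orthonormal ℝ w := by
    intro μ
    by_cases hf : FiniteDimensional ℝ (Module.End.eigenspace (T : E →ₗ[ℝ] E) μ)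
    · exact ⟨_, (stdOrthonormalBasis ℝ _).orthonormal⟩
    -- An infinite-dimensional eigenspace has `finrank` 0, so the empty family serves.
    · have h0 := Module.finrank_of_not_finite hf
      rw [h0]
      exact ⟨Fin.elim0, ⟨fun i => i.elim0, fun i => i.elim0⟩⟩
  choose w hw using hbas
  refine summable_of_sum_le (c := M) (fun μ => by positivity) fun s => ?_
  have hon : Orthonormal ℝ (fun a : (Σ μ : s,
      Fin (Module.finrank ℝ (Module.End.eigenspace (T : E →ₗ[ℝ] E) μ.1))) =>
        (w a.1.1 a.2 : E)) := by
    have h1 := hfam.comp (Subtype.val_injective : Function.Injective (fun μ : s => μ.1))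
    exact h1.orthonormal_sigma_orthonormal (v_family := fun μ : s => w μ.1) fun μ => hw μ.1
  have h2 := hM _ _ hon
  rw [Fintype.sum_sigma] at h2
  refine le_trans (le_of_eq ?_) h2
  rw [← Finset.sum_coe_sort s]
  refine Finset.sum_congr rfl fun μ _ => ?_
  -- A unit eigenvector satisfies ‖A w‖² = ⟪T w, w⟫ = μ, so each eigenvalue is counted with
  -- multiplicity in the sum bounded by M.
  have hval : ∀ i, ‖A (w μ.1 i : E)‖ ^ 2 = |μ.1| := by
    intro i
    have he : T (w μ.1 i : E) = μ.1 • (w μ.1 i : E) :=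
      Module.End.mem_eigenspace_iff.1 (w μ.1 i).2
    have hn : ‖(w μ.1 i : E)‖ = 1 := (hw μ.1).1 i
    have h3 : ‖A (w μ.1 i : E)‖ ^ 2 = μ.1 := by
      rw [← real_inner_self_eq_norm_sq, ← hTA, he, inner_smul_left,
        real_inner_self_eq_norm_sq, hn]
      simp
    rw [h3, abs_of_nonneg]
    rw [← h3]; positivity
  simp [hval]

theorem isPositiveTraceClass_of_factor [CompleteSpace E] (A : E →L[ℝ] F) (T : E →L[ℝ] E)
    (hTA : ∀ x y, ⟪T x, y⟫_ℝ = ⟪A x, A y⟫_ℝ) (M : ℝ)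
    (hM : ∀ (ι : Type) [Fintype ι] (v : ι → E), Orthonormal ℝ v → ∑ i, ‖A (v i)‖ ^ 2 ≤ M) :
    IsPositiveTraceClass T where
  isPositive := by
    refine ⟨fun x y => ?_, fun x => ?_⟩
    · change ⟪T x, y⟫_ℝ = ⟪x, T y⟫_ℝ
      rw [hTA, real_inner_comm, ← hTA, real_inner_comm]
    · change 0 ≤ ⟪T x, x⟫_ℝ
      rw [hTA]
      exact real_inner_self_nonneg
  isCompact := isCompactOperator_of_factor A T hTA M hM
  summable_eigenvalues := summable_eigenvalues_of_factor A T hTA M hM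

end HilbertSpace

end DataAug

namespace DataAug

noncomputable section

/-! ### Integral operators with square-integrable kernel. -/

section IntegralOperator

open scoped InnerProductSpace

variable {S Z : Type*} [MeasurableSpace S] [MeasurableSpace Z]
  {P : Measure S} {Q : Measure Z} {κ : S × Z → ℝ}

theorem integral_mul_eq_inner (f : Lp ℝ 2 P) {u : S → ℝ} (hu : MemLp u 2 P) :
    ∫ s, f s * u s ∂P = ⟪hu.toLp u, f⟫_ℝ := by
  rw [L2.inner_def]
  refine integral_congr_ae ?_
  filter_upwards [hu.coeFn_toLp] with s hs
  simp [hs]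

theorem norm_toLp_sq {u : S → ℝ} (hu : MemLp u 2 P) :
    ‖hu.toLp u‖ ^ 2 = ∫ s, u s ^ 2 ∂P := by
  rw [← real_inner_self_eq_norm_sq, ← integral_mul_eq_inner]
  refine integral_congr_ae ?_
  filter_upwards [hu.coeFn_toLp] with s hs
  rw [hs, sq]

variable [SFinite P] [SFinite Q]

theorem ae_memLp_two_section (hκ : MemLp κ 2 (P.prod Q)) :
    ∀ᵐ s ∂P, MemLp (fun z => κ (s, z)) 2 Q := by
  have h1 := hκ.integrable_sq.prod_right_ae
  have h2 := hκ.1.prodMk_left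
  filter_upwards [h1, h2] with s hs hs'
  exact (memLp_two_iff_integrable_sq hs').2 hs

theorem memLp_two_swap (hκ : MemLp κ 2 (P.prod Q)) :
    MemLp (fun q : Z × S => κ q.swap) 2 (Q.prod P) :=
  hκ.comp_measurePreserving Measure.measurePreserving_swap

theorem integrable_mul_kernel_mul (hκ : MemLp κ 2 (P.prod Q)) {f : S → ℝ} {g : Z → ℝ}
    (hf : MemLp f 2 P) (hg : MemLp g 2 Q) :
    Integrable (fun q : S × Z => f q.1 * κ q * g q.2) (P.prod Q) := by
  have h1 : MemLp (fun q : S × Z => f q.1 * g q.2) 2 (P.prod Q) := by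
    refine (memLp_two_iff_integrable_sq (hf.1.comp_fst.mul hg.1.comp_snd)).2 ?_
    have := hf.integrable_sq.mul_prod hg.integrable_sq
    simpa only [Pi.mul_apply, mul_pow] using this
  have h2 := h1.integrable_mul hκ
  refine h2.congr (Filter.Eventually.of_forall fun q => ?_)
  simp only [Pi.mul_apply]
  ring

theorem aestronglyMeasurable_kernel_integral (hκ : MemLp κ 2 (P.prod Q)) {f : S → ℝ}
    (hf : MemLp f 2 P) : AEStronglyMeasurable (fun z => ∫ s, f s * κ (s, z) ∂P) Q := by
  have h1 : AEStronglyMeasurable (fun q : Z × S => f q.2 * κ q.swap) (Q.prod P) :=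
    hf.1.comp_snd.mul (memLp_two_swap hκ).1
  exact h1.integral_prod_right'

theorem memLp_kernel_norm (hκ : MemLp κ 2 (P.prod Q)) :
    MemLp (fun z => Real.sqrt (∫ s, κ (s, z) ^ 2 ∂P)) 2 Q := by
  have h1 := (memLp_two_swap hκ).integrable_sq.integral_prod_left
  rw [memLp_two_iff_integrable_sq]
  · refine h1.congr (Filter.Eventually.of_forall fun z => ?_)
    dsimp only
    rw [Real.sq_sqrt (integral_nonneg fun s => sq_nonneg _)]
    rfl
  · exact Real.continuous_sqrt.comp_aestronglyMeasurable h1.1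

theorem ae_norm_kernel_integral_le (hκ : MemLp κ 2 (P.prod Q)) (f : Lp ℝ 2 P) :
    ∀ᵐ z ∂Q, ‖∫ s, f s * κ (s, z) ∂P‖ ≤ ‖f‖ * ‖Real.sqrt (∫ s, κ (s, z) ^ 2 ∂P)‖ := by
  filter_upwards [ae_memLp_two_section (memLp_two_swap hκ)] with z hz
  have hz' : MemLp (fun s => κ (s, z)) 2 P := hz
  rw [integral_mul_eq_inner f hz', ← norm_toLp_sq hz', Real.sqrt_sq (norm_nonneg _), norm_norm,
    mul_comm]
  exact norm_inner_le_norm _ _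

theorem memLp_kernel_integral (hκ : MemLp κ 2 (P.prod Q)) (f : Lp ℝ 2 P) :
    MemLp (fun z => ∫ s, f s * κ (s, z) ∂P) 2 Q :=
  (memLp_kernel_norm hκ).of_le_mul (aestronglyMeasurable_kernel_integral hκ (Lp.memLp f))
    (ae_norm_kernel_integral_le hκ f)

/-- The integral operator `L²(P) → L²(Q)` with a square-integrable kernel. -/
def kernelOp (hκ : MemLp κ 2 (P.prod Q)) : Lp ℝ 2 P →L[ℝ] Lp ℝ 2 Q :=
  LinearMap.mkContinuous
    { toFun := fun f => (memLp_kernel_integral hκ f).toLp _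
      map_add' := fun f g => by
        rw [← MemLp.toLp_add]
        refine MemLp.toLp_congr _ _ ?_
        filter_upwards [ae_memLp_two_section (memLp_two_swap hκ)] with z hz
        have hz' : MemLp (fun s => κ (s, z)) 2 P := hz
        simp only [Pi.add_apply]
        rw [integral_mul_eq_inner _ hz', integral_mul_eq_inner _ hz',
          integral_mul_eq_inner _ hz', inner_add_right]
      map_smul' := fun c f => by
        rw [RingHom.id_apply, ← MemLp.toLp_const_smul]
        refine MemLp.toLp_congr _ _ ?_
        filter_upwards [ae_memLp_two_section (memLp_two_swap hκ)] with z hz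
        have hz' : MemLp (fun s => κ (s, z)) 2 P := hz
        simp only [Pi.smul_apply]
        rw [integral_mul_eq_inner _ hz', integral_mul_eq_inner _ hz', inner_smul_right]
        rfl }
    -- The bound is the Hilbert–Schmidt norm of κ, from Cauchy–Schwarz in s for almost every z.
    ‖(memLp_kernel_norm hκ).toLp _‖ fun f => by
      rw [mul_comm]
      refine Lp.norm_le_mul_norm_of_ae_le_mul ?_
      filter_upwards [(memLp_kernel_norm hκ).coeFn_toLp, (memLp_kernel_integral hκ f).coeFn_toLp,
        ae_norm_kernel_integral_le hκ f] with z h1 h2 h3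
      change ‖((memLp_kernel_integral hκ f).toLp _ : Z → ℝ) z‖ ≤ _
      rw [h1, h2]
      exact h3

theorem kernelOp_coeFn (hκ : MemLp κ 2 (P.prod Q)) (f : Lp ℝ 2 P) :
    kernelOp hκ f =ᵐ[Q] fun z => ∫ s, f s * κ (s, z) ∂P :=
  (memLp_kernel_integral hκ f).coeFn_toLp

/-- Fubini: the adjoint has the transposed kernel. -/
theorem inner_kernelOp (hκ : MemLp κ 2 (P.prod Q)) (f : Lp ℝ 2 P) (g : Lp ℝ 2 Q) :
    ⟪kernelOp hκ f, g⟫_ℝ = ⟪f, kernelOp (memLp_two_swap hκ) g⟫_ℝ := by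
  have hint := integrable_mul_kernel_mul hκ (Lp.memLp f) (Lp.memLp g)
  rw [L2.inner_def, L2.inner_def]
  calc ∫ z, ⟪kernelOp hκ f z, g z⟫_ℝ ∂Q = ∫ z, ∫ s, f s * κ (s, z) * g z ∂P ∂Q := by
        refine integral_congr_ae ?_
        filter_upwards [kernelOp_coeFn hκ f] with z hz
        rw [integral_mul_const, hz]
        simp [mul_comm]
    _ = ∫ s, ∫ z, f s * κ (s, z) * g z ∂Q ∂P := (integral_integral_swap hint).symm
    _ = ∫ s, ⟪f s, kernelOp (memLp_two_swap hκ) g s⟫_ℝ ∂P := by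
        refine integral_congr_ae ?_
        filter_upwards [kernelOp_coeFn (memLp_two_swap hκ) g] with s hs
        rw [hs, real_inner_comm]
        simp only [Real.inner_apply, Prod.swap_prod_mk]
        rw [← integral_mul_const]
        refine integral_congr_ae (Filter.Eventually.of_forall fun z => ?_)
        dsimp only
        ring

/-- Bessel's inequality for an operator with square-integrable kernel. -/
theorem sum_norm_kernelOp_sq_le (hκ : MemLp κ 2 (P.prod Q)) {ι : Type*} [Fintype ι]
    {v : ι → Lp ℝ 2 P} (hv : Orthonormal ℝ v) :
    ∑ i, ‖kernelOp hκ (v i)‖ ^ 2 ≤ ∫ z, ∫ s, κ (s, z) ^ 2 ∂P ∂Q := by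
  have h0 : ∀ i, ‖kernelOp hκ (v i)‖ ^ 2 = ∫ z, (∫ s, v i s * κ (s, z) ∂P) ^ 2 ∂Q := fun i =>
    norm_toLp_sq (memLp_kernel_integral hκ (v i))
  simp only [h0]
  rw [← integral_finsetSum _ fun i _ => (memLp_kernel_integral hκ (v i)).integrable_sq]
  refine integral_mono_ae
    (integrable_finsetSum _ fun i _ => (memLp_kernel_integral hκ (v i)).integrable_sq)
    (memLp_two_swap hκ).integrable_sq.integral_prod_left ?_
  filter_upwards [ae_memLp_two_section (memLp_two_swap hκ)] with z hz
  have hz' : MemLp (fun s => κ (s, z)) 2 P := hz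
  -- For fixed z the numbers being squared are the coefficients of the section κ(·, z), so Bessel
  -- applies pointwise and is then integrated over z.
  have hb := hv.sum_inner_products_le (hz'.toLp _) (s := Finset.univ)
  rw [norm_toLp_sq hz'] at hb
  refine le_trans (le_of_eq ?_) hb
  refine Finset.sum_congr rfl fun i _ => ?_
  rw [integral_mul_eq_inner _ hz', real_inner_comm, Real.norm_eq_abs, sq_abs]

/-- Fubini with the section κ(s, ·) as test function in L²(Q). The integrability clause is the one
that `IsMarkovOperator` demands. -/
theorem kernelOp_swap_kernelOp (hκ : MemLp κ 2 (P.prod Q)) (f : Lp ℝ 2 P) :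
    ∀ᵐ s ∂P, Integrable (fun s' => f s' * ∫ z, κ (s', z) * κ (s, z) ∂Q) P ∧
      kernelOp (memLp_two_swap hκ) (kernelOp hκ f) s =
        ∫ s', f s' * ∫ z, κ (s', z) * κ (s, z) ∂Q ∂P := by
  filter_upwards [kernelOp_coeFn (memLp_two_swap hκ) (kernelOp hκ f), ae_memLp_two_section hκ]
    with s hs hsec
  have hint := integrable_mul_kernel_mul hκ (Lp.memLp f) hsec
  have heq : (fun s' => ∫ z, f s' * κ (s', z) * κ (s, z) ∂Q) =
      fun s' => f s' * ∫ z, κ (s', z) * κ (s, z) ∂Q := by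
    funext s'
    rw [← integral_const_mul]
    simp only [mul_assoc]
  constructor
  · have h1 := hint.integral_prod_left
    rwa [heq] at h1
  · rw [hs, ← heq, integral_integral_swap hint]
    refine integral_congr_ae ?_
    filter_upwards [kernelOp_coeFn hκ f] with z hz
    rw [hz, integral_mul_const]
    rfl

/-- Mean zero means orthogonal to the constant 1. This gives closedness, and reduces invariance
under a symmetric operator to 1 being an eigenvector. -/
theorem mem_L20_iff_inner [IsFiniteMeasure P] (f : Lp ℝ 2 P) :
    f ∈ L20 P ↔ ⟪(memLp_const (1 : ℝ)).toLp (fun _ : S => (1 : ℝ)), f⟫_ℝ = 0 := by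
  rw [← integral_mul_eq_inner]
  simp only [mul_one]
  exact ⟨fun h => h.2, fun h => ⟨(Lp.memLp f).integrable (by norm_num), h⟩⟩

theorem completeSpace_L20 [IsFiniteMeasure P] : CompleteSpace (L20 P) := by
  have h : IsClosed ((L20 P : Submodule ℝ (Lp ℝ 2 P)) : Set (Lp ℝ 2 P)) := by
    have h1 : ((L20 P : Submodule ℝ (Lp ℝ 2 P)) : Set (Lp ℝ 2 P)) =
        {f | ⟪(memLp_const (1 : ℝ)).toLp (fun _ : S => (1 : ℝ)), f⟫_ℝ = 0} := by
      ext f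
      exact mem_L20_iff_inner f
    rw [h1]
    exact isClosed_eq (by fun_prop) continuous_const
  exact h.completeSpace_coe

/-- The self-adjoint kernel `∫ κ(s', z) κ(s, z) dQ(z)` with `κ` square-integrable and with constant
total mass defines a positive trace-class operator on mean-zero functions. -/
theorem exists_positiveTraceClass_of_kernel [IsFiniteMeasure P] (hκ : MemLp κ 2 (P.prod Q)) (c : ℝ)
    (hc : ∀ᵐ s ∂P, ∫ z, κ (s, z) * ∫ s', κ (s', z) ∂P ∂Q = c) :
    ∃ K : L20 P →L[ℝ] L20 P,
      (∀ f : L20 P, ∀ᵐ s ∂P,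
        Integrable (fun s' => (f : Lp ℝ 2 P) s' * ∫ z, κ (s', z) * κ (s, z) ∂Q) P ∧
        (K f : Lp ℝ 2 P) s = ∫ s', (f : Lp ℝ 2 P) s' * ∫ z, κ (s', z) * κ (s, z) ∂Q ∂P) ∧
      IsPositiveTraceClass K := by
  have := completeSpace_L20 (P := P)
  set A := kernelOp hκ
  set B := kernelOp (memLp_two_swap hκ)
  set e : Lp ℝ 2 P := (memLp_const (1 : ℝ)).toLp (fun _ : S => (1 : ℝ)) with he
  -- Constant total mass makes the constant function an eigenvector; symmetry then keeps its
  -- orthogonal complement invariant.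
  have hBAe : B (A e) = c • e := by
    refine Lp.ext ?_
    have h1 : (e : S → ℝ) =ᵐ[P] fun _ => (1 : ℝ) := MemLp.coeFn_toLp _
    filter_upwards [kernelOp_coeFn (memLp_two_swap hκ) (A e), hc, h1, Lp.coeFn_smul c e]
      with s hs hcs h1s h2s
    rw [h2s, hs, Pi.smul_apply, h1s, smul_eq_mul, mul_one, ← hcs]
    refine integral_congr_ae ?_
    filter_upwards [kernelOp_coeFn hκ e] with z hz
    rw [hz, mul_comm]
    congr 1
    refine integral_congr_ae ?_
    filter_upwards [h1] with s' hs'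
    rw [hs', one_mul]
  have hmem : ∀ f : L20 P, (B ∘L A) (f : Lp ℝ 2 P) ∈ L20 P := by
    intro f
    rw [mem_L20_iff_inner]
    change ⟪e, B (A f)⟫_ℝ = 0
    rw [← inner_kernelOp, real_inner_comm, inner_kernelOp]
    change ⟪(f : Lp ℝ 2 P), B (A e)⟫_ℝ = 0
    rw [hBAe, inner_smul_right, real_inner_comm, (mem_L20_iff_inner _).1 f.2, mul_zero]
  refine ⟨((B ∘L A) ∘L (L20 P).subtypeL).codRestrict (L20 P) hmem, ?_, ?_⟩
  · intro f
    exact kernelOp_swap_kernelOp hκ (f : Lp ℝ 2 P)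
  · refine isPositiveTraceClass_of_factor (A ∘L (L20 P).subtypeL) _ ?_
      (∫ z, ∫ s, κ (s, z) ^ 2 ∂P ∂Q) ?_
    · intro f g
      change ⟪B (A (f : Lp ℝ 2 P)), (g : Lp ℝ 2 P)⟫_ℝ = ⟪A (f : Lp ℝ 2 P), A (g : Lp ℝ 2 P)⟫_ℝ
      rw [real_inner_comm, ← inner_kernelOp, real_inner_comm]
    · intro ι _ v hv
      exact sum_norm_kernelOp_sq_le hκ (hv.comp_linearIsometry (L20 P).subtypeₗᵢ)

end IntegralOperator

end

end DataAug

namespace DataAug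

/-! ### Integrals of products over product spaces. -/

section ProductIntegrals

theorem lintegral_fin_prod_eq_prod {n : ℕ} {E : Fin n → Type*} {mE : ∀ i, MeasurableSpace (E i)}
    (μ : ∀ i, Measure (E i)) [∀ i, SigmaFinite (μ i)] {f : ∀ i, E i → ℝ≥0∞}
    (hf : ∀ i, Measurable (f i)) :
    ∫⁻ x, ∏ i, f i (x i) ∂Measure.pi μ = ∏ i, ∫⁻ t, f i t ∂μ i := by
  induction n with
  | zero => simp
  | succ n ih =>
    rw [← ((measurePreserving_piFinSuccAbove μ 0).symm).lintegral_comp_emb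
      (MeasurableEquiv.measurableEmbedding _)]
    simp_rw [MeasurableEquiv.piFinSuccAbove_symm_apply, Fin.insertNthEquiv,
      Fin.prod_univ_succ, Equiv.coe_fn_mk, Fin.insertNth_zero]
    simp only [Fin.zero_succAbove]
    have hm : Measurable fun x : ∀ j : Fin n, E j.succ => ∏ j, f (Fin.succ j) (x j) :=
      Finset.measurable_fun_prod _ fun j _ => (hf _).comp (measurable_pi_apply j)
    have h1 := lintegral_prod_mul (μ := μ 0) (ν := Measure.pi fun j : Fin n => μ j.succ)
      (hf 0).aemeasurable hm.aemeasurable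
    have h2 := ih (fun j => μ j.succ) (f := fun j => f j.succ) fun j => hf _
    rw [h2] at h1
    exact h1

theorem lintegral_fintype_prod_eq_prod {ι : Type*} [Fintype ι] (μ : ι → Measure ℝ)
    [∀ i, SigmaFinite (μ i)] {f : ι → ℝ → ℝ≥0∞} (hf : ∀ i, Measurable (f i)) :
    ∫⁻ x, ∏ i, f i (x i) ∂Measure.pi μ = ∏ i, ∫⁻ t, f i t ∂μ i := by
  let e := (Fintype.equivFin ι).symm
  rw [← (measurePreserving_piCongrLeft μ e).lintegral_comp_emb
    (MeasurableEquiv.measurableEmbedding _)]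
  rw [← e.prod_comp, ← lintegral_fin_prod_eq_prod (fun i => μ (e i)) fun i => hf (e i)]
  refine lintegral_congr fun x => ?_
  rw [← e.prod_comp]
  simp [MeasurableEquiv.coe_piCongrLeft, Equiv.piCongrLeft_apply_apply]

theorem volume_preserving_uncurry (ι κ : Type*) [Fintype ι] [Fintype κ] :
    MeasurePreserving (MeasurableEquiv.curry ι κ ℝ).symm volume volume where
  measurable := MeasurableEquiv.measurable _
  map_eq := by
    refine (Measure.pi_eq fun s hs => ?_).symm
    rw [MeasurableEquiv.map_apply]
    have : (MeasurableEquiv.curry ι κ ℝ).symm ⁻¹' univ.pi s =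
        univ.pi fun i => univ.pi fun k => s (i, k) := by
      ext x
      simp [MeasurableEquiv.coe_curry_symm, Function.uncurry, Set.mem_pi]
    rw [this, volume_pi_pi]
    simp_rw [volume_pi_pi]
    rw [Fintype.prod_prod_type]

end ProductIntegrals

/-! ### Gaussian integrals of quadratic forms. -/

section Gaussian

open Matrix
open scoped MatrixOrder

variable {ι : Type*} [Fintype ι] [DecidableEq ι]

theorem lintegral_comp_mulVec {B : Matrix ι ι ℝ} (hB : B.det ≠ 0) (f : (ι → ℝ) → ℝ≥0∞) :
    ∫⁻ x, f (B *ᵥ x) = ENNReal.ofReal |B.det⁻¹| * ∫⁻ x, f x := by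
  have h1 := Real.map_matrix_volume_pi_eq_smul_volume_pi hB
  have hemb : MeasurableEmbedding (toLin' B) := by
    have hinj : Function.Injective (toLin' B) := by
      exact Matrix.mulVec_injective_of_isUnit ((isUnit_iff_isUnit_det B).2 hB.isUnit)
    exact (LinearMap.continuous_of_finiteDimensional _).measurableEmbedding hinj
  have h2 := hemb.lintegral_map (μ := volume) f
  rw [h1, lintegral_smul_measure] at h2
  simpa [smul_eq_mul] using h2.symm

theorem lintegral_exp_neg_half_sq :
    ∫⁻ t : ℝ, ENNReal.ofReal (Real.exp (-(1 / 2) * t ^ 2)) = ENNReal.ofReal √(2 * Real.pi) := by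
  rw [← ofReal_integral_eq_lintegral_ofReal (integrable_exp_neg_mul_sq (by norm_num))
    (Filter.Eventually.of_forall fun t => (Real.exp_pos _).le), integral_gaussian]
  congr 2
  field_simp

theorem gaussConst_pow_ne_zero (k : ℕ) : ENNReal.ofReal √(2 * Real.pi) ^ k ≠ 0 :=
  pow_ne_zero _ (ENNReal.ofReal_pos.2 (by positivity)).ne'

theorem gaussConst_pow_ne_top (k : ℕ) : ENNReal.ofReal √(2 * Real.pi) ^ k ≠ ∞ :=
  ENNReal.pow_ne_top ENNReal.ofReal_ne_top

/-- The Gaussian integral attached to a positive definite quadratic form. -/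
theorem lintegral_gaussian_quadForm {A : Matrix ι ι ℝ} (hA : A.PosDef) :
    ∫⁻ x : ι → ℝ, ENNReal.ofReal (Real.exp (-(1 / 2) * (x ⬝ᵥ A *ᵥ x))) =
      ENNReal.ofReal √(2 * Real.pi) ^ Fintype.card ι * ENNReal.ofReal (A.det ^ (-(1 / 2) : ℝ)) := by
  -- With A = Bᵀ B the substitution x ↦ B x reduces to the standard Gaussian, with Jacobian |det
  -- B|⁻¹ = (det A)^{-1/2}.
  obtain ⟨B, hB⟩ := CStarAlgebra.nonneg_iff_eq_star_mul_self.mp hA.posSemidef.nonneg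
  rw [star_eq_conjTranspose] at hB
  rw [conjTranspose_eq_transpose_of_trivial] at hB
  have hdet : A.det = B.det ^ 2 := by rw [hB, det_mul, det_transpose, sq]
  have hdetpos := hA.det_pos
  have hB0 : B.det ≠ 0 := by
    intro h
    rw [hdet, h] at hdetpos
    norm_num at hdetpos
  have h1 := lintegral_comp_mulVec hB0
    fun x => ENNReal.ofReal (Real.exp (-(1 / 2) * (x ⬝ᵥ x)))
  have h2 : ∀ x : ι → ℝ, (B *ᵥ x) ⬝ᵥ (B *ᵥ x) = x ⬝ᵥ A *ᵥ x := by
    intro x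
    rw [hB, ← mulVec_mulVec, dotProduct_mulVec x, vecMul_transpose]
  simp only [h2] at h1
  rw [h1]
  have h3 : ∀ x : ι → ℝ, ENNReal.ofReal (Real.exp (-(1 / 2) * (x ⬝ᵥ x))) =
      ∏ i, ENNReal.ofReal (Real.exp (-(1 / 2) * x i ^ 2)) := by
    intro x
    rw [← ENNReal.ofReal_prod_of_nonneg fun i _ => (Real.exp_pos _).le, ← Real.exp_sum,
      dotProduct, Finset.mul_sum]
    simp only [sq]
  simp only [h3]
  rw [volume_pi, lintegral_fintype_prod_eq_prod (fun _ : ι => volume)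
    (f := fun _ t => ENNReal.ofReal (Real.exp (-(1 / 2) * t ^ 2))) fun i => by fun_prop]
  simp only [lintegral_exp_neg_half_sq, Finset.prod_const, Finset.card_univ]
  rw [mul_comm]
  congr 2
  rw [hdet, ← sq_abs, ← Real.rpow_natCast, ← Real.rpow_mul (abs_nonneg _), abs_inv]
  norm_num
  rw [Real.rpow_neg_one]

theorem lintegral_gaussian_quadForm_sub {A : Matrix ι ι ℝ} (hA : A.PosDef) (v : ι → ℝ) :
    ∫⁻ x : ι → ℝ, ENNReal.ofReal (Real.exp (-(1 / 2) * ((x - v) ⬝ᵥ A *ᵥ (x - v)))) =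
      ENNReal.ofReal √(2 * Real.pi) ^ Fintype.card ι * ENNReal.ofReal (A.det ^ (-(1 / 2) : ℝ)) := by
  rw [← lintegral_gaussian_quadForm hA]
  exact lintegral_sub_right_eq_self
    (fun x : ι → ℝ => ENNReal.ofReal (Real.exp (-(1 / 2) * (x ⬝ᵥ A *ᵥ x)))) v

/-- The larger form has the smaller Gaussian integral, and these integrals are the determinants to
the power -1/2; no eigenvalues are needed. -/
theorem det_le_det_of_quadForm_le {A B : Matrix ι ι ℝ} (hA : A.PosDef) (hB : B.PosDef)
    (h : ∀ x : ι → ℝ, x ⬝ᵥ A *ᵥ x ≤ x ⬝ᵥ B *ᵥ x) : A.det ≤ B.det := by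
  have h1 : ∫⁻ x : ι → ℝ, ENNReal.ofReal (Real.exp (-(1 / 2) * (x ⬝ᵥ B *ᵥ x))) ≤
      ∫⁻ x : ι → ℝ, ENNReal.ofReal (Real.exp (-(1 / 2) * (x ⬝ᵥ A *ᵥ x))) := by
    refine lintegral_mono fun x => ENNReal.ofReal_le_ofReal (Real.exp_le_exp.2 ?_)
    linarith [h x]
  rw [lintegral_gaussian_quadForm hA, lintegral_gaussian_quadForm hB] at h1
  rw [ENNReal.mul_le_mul_iff_right (gaussConst_pow_ne_zero _) (gaussConst_pow_ne_top _),
    ENNReal.ofReal_le_ofReal_iff (Real.rpow_nonneg hA.det_pos.le _)] at h1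
  exact (Real.rpow_le_rpow_iff_of_neg hB.det_pos hA.det_pos (by norm_num)).1 h1

end Gaussian

section MatrixNormal

open Matrix

variable {p d : ℕ}

/-- For symmetric B, tr(A w B wᵀ) is the quadratic form of A ⊗ B in the entries of w, and det(A ⊗ B)
= (det A)^d (det B)^p. -/
theorem lintegral_matrixNormal {A : Matrix (Fin p) (Fin p) ℝ} {B : Matrix (Fin d) (Fin d) ℝ}
    (hA : A.PosDef) (hB : B.PosDef) (θ : Matrix (Fin p) (Fin d) ℝ) :
    ∫⁻ β : Fin p → Fin d → ℝ, ENNReal.ofReal (Real.exp (-(1 / 2) *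
        (A * (of β - θ) * B * (of β - θ)ᵀ).trace)) =
      ENNReal.ofReal √(2 * Real.pi) ^ (p * d) *
        ENNReal.ofReal (A.det ^ (-(d / 2) : ℝ) * B.det ^ (-(p / 2) : ℝ)) := by
  have hAB := hA.kronecker hB
  have h1 := lintegral_gaussian_quadForm_sub hAB fun q => θ q.1 q.2
  rw [← (volume_preserving_uncurry (Fin p) (Fin d)).lintegral_comp_emb
    (MeasurableEquiv.measurableEmbedding _)] at h1
  rw [det_kronecker] at h1
  simp only [Fintype.card_fin, Fintype.card_prod] at h1
  rw [Real.mul_rpow (pow_nonneg hA.det_pos.le _) (pow_nonneg hB.det_pos.le _),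
    ← Real.rpow_natCast, ← Real.rpow_natCast, ← Real.rpow_mul hA.det_pos.le,
    ← Real.rpow_mul hB.det_pos.le] at h1
  convert h1 using 2
  · funext β
    congr 3
    rw [MeasurableEquiv.coe_curry_symm]
    have hs : B.transpose = B := by
      have := hB.isHermitian
      rwa [IsHermitian, conjTranspose_eq_transpose_of_trivial] at this
    have hs' : ∀ i j, B i j = B j i := fun i j => by conv_lhs => rw [← hs, transpose_apply]
    simp only [trace, diag, mul_apply, dotProduct, mulVec, Fintype.sum_prod_type,
      kroneckerMap_apply, transpose_apply, Matrix.sub_apply, Pi.sub_apply, of_apply,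
      Function.uncurry, Finset.sum_mul, Finset.mul_sum]
    refine Finset.sum_congr rfl fun i _ => ?_
    refine Finset.sum_congr rfl fun l _ => ?_
    rw [Finset.sum_comm]
    refine Finset.sum_congr rfl fun j _ => Finset.sum_congr rfl fun k _ => ?_
    rw [hs' k l]
    ring
  · congr 3 <;> ring

end MatrixNormal

end DataAug

namespace DataAug

/-! ### Schur complements of a one-dimensional corner. -/

section Bordered

open Matrix

variable {κ : Type*}

/-- The symmetric matrix with corner entry `t`, border `u` and remaining block `V`. -/
def bordered (t : ℝ) (u : κ → ℝ) (V : Matrix κ κ ℝ) : Matrix (Unit ⊕ κ) (Unit ⊕ κ) ℝ :=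
  fromBlocks (of fun _ _ => t) (of fun _ j => u j) (of fun i _ => u i) V

variable [Fintype κ] [DecidableEq κ]

theorem isUnit_det_corner {t : ℝ} (ht : t ≠ 0) :
    IsUnit (of fun _ _ : Unit => t : Matrix Unit Unit ℝ).det := by simpa using ht

theorem schur_bordered {t : ℝ} (ht : t ≠ 0) (u : κ → ℝ) (V : Matrix κ κ ℝ) :
    V + t⁻¹ • vecMulVec u u - (of fun i (_ : Unit) => u i) * (of fun _ _ : Unit => t)⁻¹ *
      (of fun (_ : Unit) j => u j) = V := by
  have hinv : (of fun _ _ : Unit => t : Matrix Unit Unit ℝ)⁻¹ = of fun _ _ => t⁻¹ := by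
    refine inv_eq_right_inv ?_
    ext
    simp [mul_apply, ht]
  rw [hinv]
  ext i j
  simp [mul_apply, vecMulVec_apply]
  ring

/-- The lower block is written as V + t⁻¹ u uᵀ so that V is the Schur complement of the corner. -/
theorem det_bordered {t : ℝ} (ht : t ≠ 0) (u : κ → ℝ) (V : Matrix κ κ ℝ) :
    (bordered t u (V + t⁻¹ • vecMulVec u u)).det = t * V.det := by
  let _ := invertibleOfIsUnitDet _ (isUnit_det_corner ht)
  rw [bordered, det_fromBlocks₁₁, invOf_eq_nonsing_inv, schur_bordered ht]
  simp

theorem posDef_bordered_iff {t : ℝ} (ht : 0 < t) (u : κ → ℝ) (V : Matrix κ κ ℝ) :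
    (bordered t u (V + t⁻¹ • vecMulVec u u)).PosDef ↔ V.PosDef := by
  let _ := invertibleOfIsUnitDet _ (isUnit_det_corner ht.ne')
  have hA : (of fun _ _ : Unit => t : Matrix Unit Unit ℝ).PosDef := by
    have : (of fun _ _ : Unit => t : Matrix Unit Unit ℝ) = Matrix.diagonal fun _ => t := by
      ext; simp
    rw [this]
    exact posDef_diagonal_iff.2 fun _ => ht
  have h1 : (bordered t u (V + t⁻¹ • vecMulVec u u)).PosSemidef ↔ V.PosSemidef := by
    have h2 := PosDef.fromBlocks₁₁ (B := of fun (_ : Unit) j => u j)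
      (D := V + t⁻¹ • vecMulVec u u) hA
    have h3 : (of fun (_ : Unit) j => u j : Matrix Unit κ ℝ)ᴴ = of fun i _ => u i := by
      ext; simp
    rw [h3, schur_bordered ht.ne'] at h2
    exact h2
  constructor
  · intro h
    refine (h1.1 h.posSemidef).posDef_iff_det_ne_zero.2 fun h0 => ?_
    have := h.det_pos
    rw [det_bordered ht.ne', h0, mul_zero] at this
    exact lt_irrefl _ this
  · intro h
    refine (h1.2 h.posSemidef).posDef_iff_det_ne_zero.2 ?_
    rw [det_bordered ht.ne']
    exact mul_ne_zero ht.ne' h.det_pos.ne'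

theorem inv_bordered {t : ℝ} (ht : t ≠ 0) (u : κ → ℝ) {V : Matrix κ κ ℝ} (hV : V.PosDef) :
    (bordered t u (V + t⁻¹ • vecMulVec u u))⁻¹ =
      bordered (t⁻¹ + t⁻¹ ^ 2 * (u ⬝ᵥ V⁻¹ *ᵥ u)) (-(t⁻¹ • V⁻¹ *ᵥ u)) V⁻¹ := by
  have hsymm : V⁻¹.transpose = V⁻¹ := by
    have := hV.inv.isHermitian
    rwa [IsHermitian, conjTranspose_eq_transpose_of_trivial] at this
  have hVu : V *ᵥ (V⁻¹ *ᵥ u) = u := by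
    rw [mulVec_mulVec, mul_nonsing_inv _ hV.det_pos.ne'.isUnit, one_mulVec]
  have huV : u ᵥ* V⁻¹ = V⁻¹ *ᵥ u := by
    conv_lhs => rw [← hsymm, vecMul_transpose]
  refine inv_eq_right_inv ?_
  rw [bordered, bordered, fromBlocks_multiply, ← fromBlocks_one]
  congr 1
  · ext
    simp only [Matrix.add_apply, mul_apply, of_apply, Pi.neg_apply, Pi.smul_apply, smul_eq_mul,
      Finset.univ_unique, Finset.sum_singleton, one_apply_eq, dotProduct]
    have : ∑ j, u j * -(t⁻¹ * (V⁻¹ *ᵥ u) j) = -(t⁻¹ * ∑ j, u j * (V⁻¹ *ᵥ u) j) := by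
      rw [Finset.mul_sum, ← Finset.sum_neg_distrib]
      exact Finset.sum_congr rfl fun j _ => by ring
    rw [this]
    field_simp
    ring
  · ext i j
    have h1 : ∑ k, u k * V⁻¹ k j = (V⁻¹ *ᵥ u) j := by rw [← huV]; rfl
    simp only [Matrix.add_apply, mul_apply, of_apply, Pi.neg_apply, Pi.smul_apply, smul_eq_mul,
      Finset.univ_unique, Finset.sum_singleton, Matrix.zero_apply, h1]
    field_simp
    ring
  · ext i j
    have h1 : ∑ k, V i k * (V⁻¹ *ᵥ u) k = u i := congrFun hVu i
    simp only [Matrix.add_apply, mul_apply, of_apply, Pi.neg_apply, Pi.smul_apply, smul_eq_mul,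
      Finset.univ_unique, Finset.sum_singleton, Matrix.zero_apply, Matrix.smul_apply,
      vecMulVec_apply, dotProduct]
    have h2 : ∑ k, (V i k + t⁻¹ * (u i * u k)) * -(t⁻¹ * (V⁻¹ *ᵥ u) k) =
        -(t⁻¹ * ∑ k, V i k * (V⁻¹ *ᵥ u) k) - t⁻¹ ^ 2 * u i * ∑ k, u k * (V⁻¹ *ᵥ u) k := by
      rw [Finset.mul_sum, Finset.mul_sum, ← Finset.sum_neg_distrib, ← Finset.sum_sub_distrib]
      exact Finset.sum_congr rfl fun j _ => by ring
    rw [h2, h1]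
    ring
  · rw [add_mul, mul_nonsing_inv _ hV.det_pos.ne'.isUnit, smul_mul, vecMulVec_mul, huV]
    ext i j
    simp only [Matrix.add_apply, mul_apply, of_apply, Pi.neg_apply, Pi.smul_apply, smul_eq_mul,
      Finset.univ_unique, Finset.sum_singleton, Matrix.smul_apply, vecMulVec_apply]
    ring

theorem trace_bordered_mul_bordered (α b : ℝ) (γ v : κ → ℝ) (D W : Matrix κ κ ℝ) :
    (bordered α γ D * bordered b v W).trace = α * b + 2 * (γ ⬝ᵥ v) + (D * W).trace := by
  rw [bordered, bordered, fromBlocks_multiply]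
  simp only [trace, diag, Fintype.sum_sum_type, fromBlocks_apply₁₁, fromBlocks_apply₂₂,
    Matrix.add_apply, mul_apply, of_apply, Finset.univ_unique, Finset.sum_singleton,
    dotProduct, Finset.sum_add_distrib]
  ring

/-- Splits the inverse Wishart exponent into an inverse gamma term in t, a Gaussian term in the
border u, and an exponent of the same type one size smaller. -/
theorem trace_bordered_mul_inv {α t : ℝ} (hα : α ≠ 0) (ht : t ≠ 0) (γ u : κ → ℝ)
    (D : Matrix κ κ ℝ) {V : Matrix κ κ ℝ} (hV : V.PosDef) :
    (bordered α γ (D + α⁻¹ • vecMulVec γ γ) *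
        (bordered t u (V + t⁻¹ • vecMulVec u u))⁻¹).trace =
      α / t + (u - (t / α) • γ) ⬝ᵥ ((α / t ^ 2) • V⁻¹) *ᵥ (u - (t / α) • γ) +
        (D * V⁻¹).trace := by
  have hsymm : V⁻¹.transpose = V⁻¹ := by
    have := hV.inv.isHermitian
    rwa [IsHermitian, conjTranspose_eq_transpose_of_trivial] at this
  have hcomm : u ⬝ᵥ V⁻¹ *ᵥ γ = γ ⬝ᵥ V⁻¹ *ᵥ u := by
    rw [dotProduct_mulVec, ← mulVec_transpose, hsymm, dotProduct_comm]
  rw [inv_bordered ht u hV, trace_bordered_mul_bordered, add_mul, trace_add, smul_mul,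
    trace_smul, vecMulVec_mul, trace_vecMulVec, dotProduct_comm γ (γ ᵥ* V⁻¹),
    ← dotProduct_mulVec]
  simp only [smul_mulVec, mulVec_sub, mulVec_smul, dotProduct_smul, dotProduct_sub,
    sub_dotProduct, smul_dotProduct, smul_eq_mul, dotProduct_neg, hcomm]
  field_simp
  ring

theorem exists_bordered_of_posDef {Ψ : Matrix (Unit ⊕ κ) (Unit ⊕ κ) ℝ} (hΨ : Ψ.PosDef) :
    ∃ (α : ℝ) (γ : κ → ℝ) (D : Matrix κ κ ℝ), 0 < α ∧ D.PosDef ∧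
      Ψ = bordered α γ (D + α⁻¹ • vecMulVec γ γ) := by
  set α := Ψ (.inl ()) (.inl ()) with hα
  set γ : κ → ℝ := fun i => Ψ (.inr i) (.inl ()) with hγ
  have hαpos : 0 < α := hΨ.diag_pos
  have heq : Ψ = bordered α γ ((Ψ.toBlocks₂₂ - α⁻¹ • vecMulVec γ γ) + α⁻¹ • vecMulVec γ γ) := by
    rw [sub_add_cancel]
    have hs : ∀ i j, Ψ i j = Ψ j i := fun i j => by
      have := hΨ.isHermitian.apply i j
      simpa using this.symm
    ext (i | i) (j | j)
    · rfl
    · exact hs _ _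
    · rfl
    · rfl
  refine ⟨α, γ, _, hαpos, ?_, heq⟩
  rw [heq] at hΨ
  exact (posDef_bordered_iff hαpos _ _).1 hΨ

end Bordered

/-! ### The inverse gamma integral. -/

section GammaIntegral

theorem lintegral_inverse_gamma {r α : ℝ} (hr : 1 < r) (hα : 0 < α) :
    ∫⁻ t in Ioi (0 : ℝ), ENNReal.ofReal (t ^ (-r) * Real.exp (-(1 / 2) * (α / t))) =
      ENNReal.ofReal (2 ^ (r - 1) * Real.Gamma (r - 1)) * ENNReal.ofReal (α ^ (1 - r)) := by
  set g : ℝ → ℝ := fun y => y ^ (r - 1 - 1) * Real.exp (-(α / 2 * y)) with hg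
  have hgi : IntegrableOn g (Ioi 0) := by
    have := integrableOn_rpow_mul_exp_neg_mul_rpow (p := 1) (s := r - 1 - 1) (b := α / 2)
      (by linarith) (by norm_num) (by positivity)
    refine this.congr_fun (fun y hy => ?_) measurableSet_Ioi
    simp [hg]
  -- The substitution t ↦ 1/t turns the integral into a gamma integral; r > 1 gives convergence.
  have h1 := integral_comp_rpow_Ioi g (p := -1) (by norm_num)
  have h2 := (integrableOn_Ioi_comp_rpow_iff g (p := -1) (by norm_num)).2 hgi
  have heq : ∀ t ∈ Ioi (0 : ℝ), (|(-1 : ℝ)| * t ^ ((-1 : ℝ) - 1)) • g (t ^ (-1 : ℝ)) =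
      t ^ (-r) * Real.exp (-(1 / 2) * (α / t)) := by
    intro t ht
    have ht0 : (0 : ℝ) < t := ht
    simp only [hg, abs_neg, abs_one, one_mul, smul_eq_mul]
    rw [← Real.rpow_mul ht0.le, ← mul_assoc, ← Real.rpow_add ht0, Real.rpow_neg_one]
    congr 2
    · ring
    · field_simp
  rw [setIntegral_congr_fun measurableSet_Ioi heq] at h1
  have h3 : IntegrableOn (fun t : ℝ => t ^ (-r) * Real.exp (-(1 / 2) * (α / t))) (Ioi 0) :=
    h2.congr_fun heq measurableSet_Ioi
  rw [← ofReal_integral_eq_lintegral_ofReal h3, h1,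
    Real.integral_rpow_mul_exp_neg_mul_Ioi (by linarith) (by positivity), ← ENNReal.ofReal_mul]
  · congr 1
    rw [show (1 : ℝ) / (α / 2) = 2 * α⁻¹ by field_simp, Real.mul_rpow (by norm_num) (by positivity),
      Real.inv_rpow hα.le, ← Real.rpow_neg hα.le, neg_sub]
    ring
  · have := Real.Gamma_pos_of_pos (show 0 < r - 1 by linarith)
    positivity
  · refine (ae_restrict_mem measurableSet_Ioi).mono fun t ht => ?_
    have : (0 : ℝ) < t := ht
    positivity

end GammaIntegral

end DataAug

namespace DataAug

/-! ### Measurability of matrix functions. -/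

section Measurability

open Matrix

variable {α ι : Type*} [MeasurableSpace α] [Fintype ι] [DecidableEq ι]

theorem measurable_matrix_det {A : α → Matrix ι ι ℝ} (hA : ∀ i j, Measurable fun x => A x i j) :
    Measurable fun x => (A x).det := by
  simp only [det_apply]
  exact Finset.measurable_fun_sum _ fun σ _ =>
    (Finset.measurable_fun_prod _ fun i _ => hA _ _).const_smul _

/-- Cramer's rule; it also covers singular matrices, where both the inverse matrix and the
reciprocal of the determinant are 0. -/
theorem measurable_matrix_inv {A : α → Matrix ι ι ℝ} (hA : ∀ i j, Measurable fun x => A x i j)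
    (i j : ι) : Measurable fun x => (A x)⁻¹ i j := by
  simp only [inv_def, Matrix.smul_apply, Ring.inverse_eq_inv', smul_eq_mul, adjugate_apply]
  refine (measurable_matrix_det hA).inv.mul (measurable_matrix_det fun k l => ?_)
  by_cases hk : k = j
  · subst hk
    simp
  · simpa [updateRow_ne hk] using hA k l

theorem measurable_trace_mul {κ : Type*} [Fintype κ] {A : α → Matrix ι κ ℝ} {B : α → Matrix κ ι ℝ}
    (hA : ∀ i j, Measurable fun x => A x i j) (hB : ∀ i j, Measurable fun x => B x i j) :
    Measurable fun x => (A x * B x).trace := by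
  simp only [trace, diag, mul_apply]
  exact Finset.measurable_fun_sum _ fun i _ => Finset.measurable_fun_sum _ fun k _ =>
    (hA _ _).mul (hB _ _)

theorem measurable_symMat {d : ℕ} (i j : Fin d) :
    Measurable fun s : SymIdx d → ℝ => symMat s i j :=
  measurable_pi_apply _

theorem isHermitian_symMat {d : ℕ} (s : SymIdx d → ℝ) : (symMat s).IsHermitian := by
  ext i j
  simp [symMat, min_comm, max_comm]

/-- Semidefiniteness is a closed condition, and definiteness adds only a nonzero determinant. -/
theorem measurableSet_symMat_posDef (d : ℕ) :
    MeasurableSet {s : SymIdx d → ℝ | (symMat s).PosDef} := by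
  have h1 : {s : SymIdx d → ℝ | (symMat s).PosDef} =
      (⋂ x : Fin d → ℝ, {s | 0 ≤ x ⬝ᵥ symMat s *ᵥ x}) ∩ {s | (symMat s).det ≠ 0} := by
    ext s
    simp only [mem_ofPred_eq, mem_inter_iff, mem_iInter]
    constructor
    · intro h
      exact ⟨fun x => by simpa using h.posSemidef.dotProduct_mulVec_nonneg x, h.det_pos.ne'⟩
    · rintro ⟨h, h0⟩
      have h2 : (symMat s).PosSemidef :=
        PosSemidef.of_dotProduct_mulVec_nonneg (isHermitian_symMat s) fun x => by simpa using h x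
      exact h2.posDef_iff_det_ne_zero.2 h0
  rw [h1]
  refine MeasurableSet.inter (IsClosed.measurableSet ?_) ?_
  · refine isClosed_iInter fun x => isClosed_le continuous_const ?_
    simp only [dotProduct, mulVec, symMat, of_apply]
    fun_prop
  · exact (measurable_matrix_det measurable_symMat) (measurableSet_singleton 0).compl

end Measurability

/-! ### Splitting the coordinates of a symmetric matrix into corner, border and block. -/

section SymmetricCoordinates

open Matrix

/-- Coordinates of a symmetric matrix of size `d + 1`: corner, border, remaining block. -/
def symIdxSuccMap (d : ℕ) : Unit ⊕ (Fin d ⊕ SymIdx d) → SymIdx (d + 1)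
  | .inl _ => ⟨(0, 0), le_rfl⟩
  | .inr (.inl j) => ⟨(0, j.succ), Fin.zero_le _⟩
  | .inr (.inr k) => ⟨(k.1.1.succ, k.1.2.succ), Fin.succ_le_succ_iff.2 k.2⟩

theorem bijective_symIdxSuccMap (d : ℕ) : Function.Bijective (symIdxSuccMap d) := by
  constructor
  · rintro (_ | j | ⟨⟨i, j⟩, hij⟩) (_ | j' | ⟨⟨i', j'⟩, hij'⟩) h <;>
      simp_all [symIdxSuccMap, Fin.succ_ne_zero, (Fin.succ_ne_zero _).symm]
  · rintro ⟨⟨i, j⟩, hij⟩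
    induction i using Fin.cases with
    | zero =>
      induction j using Fin.cases with
      | zero => exact ⟨.inl (), rfl⟩
      | succ j => exact ⟨.inr (.inl j), rfl⟩
    | succ i =>
      induction j using Fin.cases with
      | zero => exact absurd hij (by simp)
      | succ j => exact ⟨.inr (.inr ⟨(i, j), Fin.succ_le_succ_iff.1 hij⟩), rfl⟩

/-- The bijection underlying `symIdxSuccMap`. -/
noncomputable def symIdxSuccEquiv (d : ℕ) : Unit ⊕ (Fin d ⊕ SymIdx d) ≃ SymIdx (d + 1) :=
  Equiv.ofBijective _ (bijective_symIdxSuccMap d)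

/-- Assemble the coordinates of a symmetric matrix from corner, border and remaining block. -/
noncomputable def symGlue {d : ℕ} (t : ℝ) (u : Fin d → ℝ) (v : SymIdx d → ℝ) :
    SymIdx (d + 1) → ℝ :=
  fun k => Sum.elim (fun _ => t) (Sum.elim u v) ((symIdxSuccEquiv d).symm k)

theorem symGlue_apply {d : ℕ} (t : ℝ) (u : Fin d → ℝ) (v : SymIdx d → ℝ)
    (q : Unit ⊕ (Fin d ⊕ SymIdx d)) :
    symGlue t u v (symIdxSuccMap d q) = Sum.elim (fun _ => t) (Sum.elim u v) q := by
  have : symIdxSuccMap d q = symIdxSuccEquiv d q := rfl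
  rw [symGlue, this, Equiv.symm_apply_apply]

/-- `Fin (d + 1)` as a point followed by `Fin d`. -/
def finSuccSumEquiv (d : ℕ) : Fin (d + 1) ≃ Unit ⊕ Fin d :=
  (finSuccEquiv d).trans ((Equiv.optionEquivSumPUnit (Fin d)).trans (Equiv.sumComm _ _))

@[simp] theorem finSuccSumEquiv_zero (d : ℕ) : finSuccSumEquiv d 0 = .inl () := rfl

@[simp] theorem finSuccSumEquiv_succ (d : ℕ) (i : Fin d) :
    finSuccSumEquiv d i.succ = .inr i := by
  simp [finSuccSumEquiv]

theorem symMat_symGlue {d : ℕ} (t : ℝ) (u : Fin d → ℝ) (v : SymIdx d → ℝ) :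
    symMat (symGlue t u v) =
      (bordered t u (symMat v)).submatrix (finSuccSumEquiv d) (finSuccSumEquiv d) := by
  ext i j
  induction i using Fin.cases with
  | zero =>
    induction j using Fin.cases with
    | zero => exact symGlue_apply t u v (.inl ())
    | succ j =>
      rw [submatrix_apply, finSuccSumEquiv_zero, finSuccSumEquiv_succ]
      exact symGlue_apply t u v (.inr (.inl j))
  | succ i =>
    induction j using Fin.cases with
    | zero =>
      rw [submatrix_apply, finSuccSumEquiv_zero, finSuccSumEquiv_succ]
      exact symGlue_apply t u v (.inr (.inl i))
    | succ j =>
      rw [submatrix_apply, finSuccSumEquiv_succ, finSuccSumEquiv_succ]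
      have h := symGlue_apply t u v (.inr (.inr ⟨(min i j, max i j), min_le_max⟩))
      refine Eq.trans ?_ h
      simp only [symMat, of_apply, symIdxSuccMap]
      congr 1
      ext1
      have hm := (Fin.strictMono_succ (n := d)).monotone
      exact Prod.ext hm.map_min.symm hm.map_max.symm

theorem measurable_symGlue (d : ℕ) :
    Measurable fun q : ℝ × (Fin d → ℝ) × (SymIdx d → ℝ) => symGlue q.1 q.2.1 q.2.2 := by
  refine measurable_pi_lambda _ fun k => ?_
  simp only [symGlue]
  rcases (symIdxSuccEquiv d).symm k with _ | j | l
  · exact measurable_fst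
  · exact (measurable_pi_apply j).comp (measurable_fst.comp measurable_snd)
  · exact (measurable_pi_apply l).comp (measurable_snd.comp measurable_snd)

theorem lintegral_symIdx_succ {d : ℕ} {F : (SymIdx (d + 1) → ℝ) → ℝ≥0∞} (hF : Measurable F) :
    ∫⁻ x, F x = ∫⁻ t : ℝ, ∫⁻ u : Fin d → ℝ, ∫⁻ v : SymIdx d → ℝ, F (symGlue t u v) := by
  have h1 := volume_measurePreserving_piCongrLeft (fun _ : SymIdx (d + 1) => ℝ) (symIdxSuccEquiv d)
  have h2 := (volume_measurePreserving_sumPiEquivProdPi_symm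
    fun _ : Unit ⊕ (Fin d ⊕ SymIdx d) => ℝ)
  have h3 := (volume_measurePreserving_sumPiEquivProdPi_symm fun _ : Fin d ⊕ SymIdx d => ℝ)
  have h4 := (volume_preserving_funUnique Unit ℝ).symm
  have h5 := h1.comp (h2.comp (h4.prod h3))
  have h6 : (fun q : ℝ × (Fin d → ℝ) × (SymIdx d → ℝ) => symGlue q.1 q.2.1 q.2.2) =
      (MeasurableEquiv.piCongrLeft (fun _ : SymIdx (d + 1) => ℝ) (symIdxSuccEquiv d)) ∘
      ((MeasurableEquiv.sumPiEquivProdPi fun _ : Unit ⊕ (Fin d ⊕ SymIdx d) => ℝ).symm ∘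
      Prod.map (MeasurableEquiv.funUnique Unit ℝ).symm
        (MeasurableEquiv.sumPiEquivProdPi fun _ : Fin d ⊕ SymIdx d => ℝ).symm) := by
    funext q k
    obtain ⟨l, rfl⟩ := (symIdxSuccEquiv d).surjective k
    simp only [Function.comp_apply, MeasurableEquiv.coe_piCongrLeft,
      Equiv.piCongrLeft_apply_apply]
    rw [symGlue, Equiv.symm_apply_apply]
    rcases l with _ | j | l <;> rfl
  rw [← h6] at h5
  have h7 := h5.lintegral_comp hF
  rw [← h7]
  have h8 := hF.comp (measurable_symGlue d)
  erw [lintegral_prod _ h8.aemeasurable]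
  refine lintegral_congr fun t => ?_
  exact lintegral_prod _ (h8.comp measurable_prodMk_left).aemeasurable

end SymmetricCoordinates

end DataAug

namespace DataAug

/-! ### The inverse Wishart integral, by induction on the size. -/

section InverseWishart

open Matrix

variable {d : ℕ}

theorem symMat_add_outer (t : ℝ) (u : Fin d → ℝ) (v : SymIdx d → ℝ) :
    symMat (v + fun k : SymIdx d => t⁻¹ * (u k.1.1 * u k.1.2)) =
      symMat v + t⁻¹ • vecMulVec u u := by
  ext i j
  simp only [symMat, of_apply, Pi.add_apply, Matrix.add_apply, Matrix.smul_apply,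
    vecMulVec_apply, smul_eq_mul]
  rcases le_total i j with h | h
  · simp [h]
  · simp [h, mul_comm]

theorem measurable_invWishart_kernel (s : ℝ) (Ψ : Matrix (Fin d) (Fin d) ℝ) :
    Measurable fun x : SymIdx d → ℝ => ENNReal.ofReal ((symMat x).det ^ (-s) *
      Real.exp (-(1 / 2) * (Ψ * (symMat x)⁻¹).trace)) := by
  refine ENNReal.measurable_ofReal.comp (Measurable.mul ?_ ?_)
  · exact (measurable_matrix_det measurable_symMat).pow_const _
  · exact Real.measurable_exp.comp ((measurable_trace_mul (A := fun _ => Ψ)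
      (B := fun x : SymIdx d → ℝ => (symMat x)⁻¹) (fun _ _ => measurable_const)
      (measurable_matrix_inv measurable_symMat)).const_mul _)

theorem posDef_symMat_symGlue_iff {t : ℝ} (ht : 0 < t) (u : Fin d → ℝ) (v : SymIdx d → ℝ) :
    (symMat (symGlue t u (v + fun k : SymIdx d => t⁻¹ * (u k.1.1 * u k.1.2)))).PosDef ↔
      (symMat v).PosDef := by
  rw [symMat_symGlue, symMat_add_outer, ← posDef_bordered_iff ht u]
  constructor
  · intro h
    have := h.submatrix (finSuccSumEquiv d).symm.injective
    simpa using this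
  · intro h
    exact h.submatrix (finSuccSumEquiv d).injective

/-- Integrating out the border of a positive definite matrix. -/
theorem lintegral_border {t α : ℝ} (ht : 0 < t) (hα : 0 < α) (s : ℝ) (γ : Fin d → ℝ)
    (D : Matrix (Fin d) (Fin d) ℝ) {V : Matrix (Fin d) (Fin d) ℝ} (hV : V.PosDef) :
    ∫⁻ u : Fin d → ℝ, ENNReal.ofReal ((t * V.det) ^ (-s) * Real.exp (-(1 / 2) *
        (α / t + (u - (t / α) • γ) ⬝ᵥ ((α / t ^ 2) • V⁻¹) *ᵥ (u - (t / α) • γ) +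
          (D * V⁻¹).trace))) =
      ENNReal.ofReal √(2 * Real.pi) ^ d * ENNReal.ofReal (α ^ (-(d / 2) : ℝ)) *
        ENNReal.ofReal (t ^ (-(s - d)) * Real.exp (-(1 / 2) * (α / t))) *
        ENNReal.ofReal (V.det ^ (-(s - 1 / 2)) * Real.exp (-(1 / 2) * (D * V⁻¹).trace)) := by
  have hVd := hV.det_pos
  have hA : ((α / t ^ 2) • V⁻¹).PosDef := hV.inv.smul (by positivity)
  have h1 := lintegral_gaussian_quadForm_sub hA ((t / α) • γ)
  have hc : 0 ≤ (t * V.det) ^ (-s) *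
      (Real.exp (-(1 / 2) * (α / t)) * Real.exp (-(1 / 2) * (D * V⁻¹).trace)) := by positivity
  have h2 : ∀ u : Fin d → ℝ, ENNReal.ofReal ((t * V.det) ^ (-s) * Real.exp (-(1 / 2) *
        (α / t + (u - (t / α) • γ) ⬝ᵥ ((α / t ^ 2) • V⁻¹) *ᵥ (u - (t / α) • γ) +
          (D * V⁻¹).trace))) =
      ENNReal.ofReal ((t * V.det) ^ (-s) *
        (Real.exp (-(1 / 2) * (α / t)) * Real.exp (-(1 / 2) * (D * V⁻¹).trace))) *
      ENNReal.ofReal (Real.exp (-(1 / 2) *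
        ((u - (t / α) • γ) ⬝ᵥ ((α / t ^ 2) • V⁻¹) *ᵥ (u - (t / α) • γ)))) := by
    intro u
    rw [← ENNReal.ofReal_mul hc, mul_assoc, ← Real.exp_add, ← Real.exp_add]
    congr 3
    ring
  simp only [h2]
  rw [lintegral_const_mul' _ _ ENNReal.ofReal_ne_top, h1, Fintype.card_fin, det_smul,
    det_nonsing_inv, Ring.inverse_eq_inv', Fintype.card_fin]
  rw [mul_left_comm, mul_assoc, mul_assoc]
  congr 1
  rw [← ENNReal.ofReal_mul hc, ← ENNReal.ofReal_mul (by positivity),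
    ← ENNReal.ofReal_mul (by positivity)]
  congr 1
  have e1 : ((α / t ^ 2) ^ d * V.det⁻¹) ^ (-(1 / 2) : ℝ) =
      α ^ (-(d / 2) : ℝ) * t ^ (d : ℝ) * V.det ^ (1 / 2 : ℝ) := by
    rw [Real.mul_rpow (by positivity) (by positivity), Real.inv_rpow hVd.le, ← Real.rpow_neg hVd.le,
      neg_neg, ← Real.rpow_natCast, ← Real.rpow_mul (by positivity),
      Real.div_rpow hα.le (by positivity), ← Real.rpow_natCast, ← Real.rpow_mul ht.le,
      div_eq_mul_inv, ← Real.rpow_neg ht.le]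
    congr 3
    · ring
    · push_cast
      ring
  have e2 : t ^ (-(s - d)) = t ^ (-s) * t ^ (d : ℝ) := by
    rw [← Real.rpow_add ht]
    congr 1
    ring
  have e3 : V.det ^ (-(s - 1 / 2)) = V.det ^ (-s) * V.det ^ (1 / 2 : ℝ) := by
    rw [← Real.rpow_add hVd]
    congr 1
    ring
  rw [e1, e2, e3, Real.mul_rpow ht.le hVd.le]
  ring

/-- The inverse Wishart integral, up to the value of the normalizing constant. -/
theorem exists_lintegral_invWishart (d : ℕ) : ∀ s : ℝ, (d : ℝ) < s →
    ∃ C : ℝ≥0∞, C ≠ 0 ∧ C ≠ ∞ ∧ ∀ Ψ : Matrix (Fin d) (Fin d) ℝ, Ψ.PosDef →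
      ∫⁻ x in {x : SymIdx d → ℝ | (symMat x).PosDef}, ENNReal.ofReal ((symMat x).det ^ (-s) *
          Real.exp (-(1 / 2) * (Ψ * (symMat x)⁻¹).trace)) =
        C * ENNReal.ofReal (Ψ.det ^ (-(s - (d + 1) / 2))) := by
  induction d with
  | zero =>
    intro s _
    refine ⟨1, one_ne_zero, ENNReal.one_ne_top, fun Ψ _ => ?_⟩
    have : IsEmpty (SymIdx 0) := ⟨fun k => k.1.1.elim0⟩
    have h1 : {x : SymIdx 0 → ℝ | (symMat x).PosDef} = univ := by
      ext x
      simp only [mem_ofPred_eq, mem_univ, iff_true]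
      have : symMat x = 1 := by
        ext i
        exact i.elim0
      rw [this]
      exact PosDef.one
    rw [h1, Measure.restrict_univ]
    simp [trace, volume_pi]
  | succ d ih =>
    intro s hs
    push_cast at hs
    -- The Gaussian integral over the border contributes (det V)^{1/2}, which lowers the exponent by
    -- 1/2.
    obtain ⟨C, hC0, hCtop, hC⟩ := ih (s - 1 / 2) (by linarith)
    have hG : 0 < Real.Gamma (s - d - 1) := Real.Gamma_pos_of_pos (by linarith)
    refine ⟨ENNReal.ofReal √(2 * Real.pi) ^ d *
        ENNReal.ofReal (2 ^ (s - d - 1) * Real.Gamma (s - d - 1)) * C, ?_, ?_, fun Ψ hΨ => ?_⟩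
    · exact mul_ne_zero (mul_ne_zero (gaussConst_pow_ne_zero _)
        (ENNReal.ofReal_pos.2 (by positivity)).ne') hC0
    · exact ENNReal.mul_ne_top (ENNReal.mul_ne_top (gaussConst_pow_ne_top _)
        ENNReal.ofReal_ne_top) hCtop
    set e := finSuccSumEquiv d
    obtain ⟨α, γ, D, hα, hD, hΨ'⟩ := exists_bordered_of_posDef (hΨ.submatrix e.symm.injective)
    have hΨe : Ψ = (bordered α γ (D + α⁻¹ • vecMulVec γ γ)).submatrix e e := by
      rw [← hΨ']
      simp
    have hΨdet : Ψ.det = α * D.det := by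
      rw [hΨe, det_submatrix_equiv_self, det_bordered hα.ne']
    rw [← lintegral_indicator (measurableSet_symMat_posDef (d + 1))]
    set F : (SymIdx (d + 1) → ℝ) → ℝ≥0∞ := indicator {x | (symMat x).PosDef}
      fun x => ENNReal.ofReal ((symMat x).det ^ (-s) *
          Real.exp (-(1 / 2) * (Ψ * (symMat x)⁻¹).trace)) with hFdef
    have hF : Measurable F :=
      (measurable_invWishart_kernel s Ψ).indicator (measurableSet_symMat_posDef (d + 1))
    rw [lintegral_symIdx_succ hF]
    have key : ∀ t : ℝ, ∫⁻ u : Fin d → ℝ, ∫⁻ v : SymIdx d → ℝ, F (symGlue t u v) =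
        indicator (Ioi 0) (fun t => ENNReal.ofReal √(2 * Real.pi) ^ d *
          ENNReal.ofReal (α ^ (-(d / 2) : ℝ)) *
          ENNReal.ofReal (t ^ (-(s - d)) * Real.exp (-(1 / 2) * (α / t))) *
          (C * ENNReal.ofReal (D.det ^ (-(s - 1 / 2 - (d + 1) / 2))))) t := by
      intro t
      -- Diagonal entries of a positive definite matrix are positive, so t ≤ 0 contributes nothing.
      by_cases ht : 0 < t
      swap
      · rw [indicator_of_notMem (by simpa using ht)]
        have : ∀ u v, F (symGlue t u v) = 0 := by
          intro u v
          refine indicator_of_notMem (fun h => ht ?_) _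
          have h0 : 0 < symMat (symGlue t u v) 0 0 := (show (symMat _).PosDef from h).diag_pos
          rw [symMat_symGlue] at h0
          exact h0
        simp [this]
      rw [indicator_of_mem (show t ∈ Ioi 0 from ht)]
      -- Translation by t⁻¹ u uᵀ makes the Schur complement the integration variable, with Jacobian
      -- 1.
      have htr : ∀ u : Fin d → ℝ, ∫⁻ v : SymIdx d → ℝ, F (symGlue t u v) =
          ∫⁻ v : SymIdx d → ℝ,
            F (symGlue t u (v + fun k : SymIdx d => t⁻¹ * (u k.1.1 * u k.1.2))) := fun u =>
        (lintegral_add_right_eq_self (fun v : SymIdx d → ℝ => F (symGlue t u v)) _).symm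
      simp only [htr]
      have hmeas : Measurable fun q : (Fin d → ℝ) × (SymIdx d → ℝ) =>
          F (symGlue t q.1 (q.2 + fun k : SymIdx d => t⁻¹ * (q.1 k.1.1 * q.1 k.1.2))) := by
        refine hF.comp ((measurable_symGlue d).comp
          (f := fun q : (Fin d → ℝ) × (SymIdx d → ℝ) => (t, q.1,
            (q.2 + fun k : SymIdx d => t⁻¹ * (q.1 k.1.1 * q.1 k.1.2)))) ?_)
        fun_prop
      rw [lintegral_lintegral_swap hmeas.aemeasurable]
      rw [← hC D hD, ← lintegral_indicator (measurableSet_symMat_posDef d),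
        ← lintegral_const_mul _ ((measurable_invWishart_kernel _ D).indicator
          (measurableSet_symMat_posDef d))]
      refine lintegral_congr fun v => ?_
      by_cases hv : (symMat v).PosDef
      · rw [indicator_of_mem (show v ∈ {x : SymIdx d → ℝ | (symMat x).PosDef} from hv),
          ← lintegral_border ht hα s γ D hv]
        refine lintegral_congr fun u => ?_
        rw [hFdef, indicator_of_mem (show _ ∈ {x : SymIdx (d + 1) → ℝ | (symMat x).PosDef} from
          (posDef_symMat_symGlue_iff ht u v).2 hv)]
        rw [symMat_symGlue, symMat_add_outer, det_submatrix_equiv_self, det_bordered ht.ne',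
          inv_submatrix_equiv, hΨe, submatrix_mul_equiv, ← trace_bordered_mul_inv hα.ne' ht.ne' γ u D hv]
        congr 4
        simp only [trace, diag, submatrix_apply]
        exact e.sum_comp fun i => (bordered α γ (D + α⁻¹ • vecMulVec γ γ) *
          (bordered t u (symMat v + t⁻¹ • vecMulVec u u))⁻¹) i i
      · rw [indicator_of_notMem (show v ∉ {x : SymIdx d → ℝ | (symMat x).PosDef} from hv), mul_zero]
        have : ∀ u : Fin d → ℝ,
            F (symGlue t u (v + fun k : SymIdx d => t⁻¹ * (u k.1.1 * u k.1.2))) = 0 := fun u =>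
          indicator_of_notMem (fun h : _ ∈ {x : SymIdx (d + 1) → ℝ | (symMat x).PosDef} =>
            hv ((posDef_symMat_symGlue_iff ht u v).1 h)) _
        simp [this]
    simp only [key]
    rw [lintegral_indicator measurableSet_Ioi, lintegral_mul_const', lintegral_const_mul',
      lintegral_inverse_gamma (by linarith) hα]
    rotate_left
    · exact ENNReal.mul_ne_top (gaussConst_pow_ne_top _) ENNReal.ofReal_ne_top
    · exact ENNReal.mul_ne_top hCtop ENNReal.ofReal_ne_top
    have hfin : ENNReal.ofReal (Ψ.det ^ (-(s - ((d + 1 : ℕ) + 1) / 2))) =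
        ENNReal.ofReal (α ^ (-(d / 2) : ℝ)) * ENNReal.ofReal (α ^ (1 - (s - d))) *
          ENNReal.ofReal (D.det ^ (-(s - 1 / 2 - (d + 1) / 2))) := by
      have hDd := hD.det_pos
      rw [← ENNReal.ofReal_mul (by positivity), ← ENNReal.ofReal_mul (by positivity),
        ← Real.rpow_add hα, hΨdet, Real.mul_rpow hα.le hDd.le]
      congr 3
      · push_cast
        ring
      · push_cast
        ring
    rw [hfin]
    ring

end InverseWishart

end DataAug

namespace DataAug

/-! ### Completing the square; the conditional laws given the latent weights. -/

section Model

open Matrix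

variable {n p d : ℕ} (X : Matrix (Fin n) (Fin p) ℝ) (y : Matrix (Fin n) (Fin d) ℝ)

/-- The weighted cross-product matrix `Xᵀ diag(z) X`. -/
def crossMat {ι κ : Type*} [Fintype ι] [DecidableEq ι] (M : Matrix ι κ ℝ) (z : ι → ℝ) :
    Matrix κ κ ℝ :=
  Mᵀ * Matrix.diagonal z * M

theorem transpose_crossMat {ι κ : Type*} [Fintype ι] [DecidableEq ι] (M : Matrix ι κ ℝ)
    (z : ι → ℝ) :
    (crossMat M z)ᵀ = crossMat M z := by
  simp [crossMat, transpose_mul, Matrix.mul_assoc]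

theorem omegaMat_eq (z : Fin n → ℝ) : omegaMat X z = (crossMat X z)⁻¹ := rfl

variable {X} in
theorem inv_omegaMat {z : Fin n → ℝ} (hz : (crossMat X z).PosDef) :
    (omegaMat X z)⁻¹ = crossMat X z := by
  rw [omegaMat_eq, nonsing_inv_nonsing_inv _ hz.det_pos.ne'.isUnit]

variable {X} in
theorem crossMat_mul_muMat {z : Fin n → ℝ} (hz : (crossMat X z).PosDef) :
    crossMat X z * muMat X y z = Xᵀ * Matrix.diagonal z * y := by
  rw [muMat, omegaMat_eq]
  simp only [← Matrix.mul_assoc]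
  rw [mul_nonsing_inv _ hz.det_pos.ne'.isUnit, Matrix.one_mul]

variable {X} in
/-- Completing the square in `β`. -/
theorem complete_square {z : Fin n → ℝ} (hz : (crossMat X z).PosDef)
    (β : Matrix (Fin p) (Fin d) ℝ) :
    (X * β - y)ᵀ * Matrix.diagonal z * (X * β - y) =
      (β - muMat X y z)ᵀ * crossMat X z * (β - muMat X y z) + residMat X y z := by
  have h1 := crossMat_mul_muMat y hz
  have h2 : (muMat X y z)ᵀ * crossMat X z = yᵀ * Matrix.diagonal z * X := by
    have := congrArg transpose h1
    simpa [transpose_mul, transpose_crossMat, Matrix.mul_assoc] using this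
  have h3 : (muMat X y z)ᵀ * crossMat X z * β = yᵀ * Matrix.diagonal z * X * β := by rw [h2]
  have h4 : βᵀ * crossMat X z * muMat X y z = βᵀ * (Xᵀ * Matrix.diagonal z * y) := by
    rw [Matrix.mul_assoc, h1]
  rw [residMat, inv_omegaMat hz]
  simp only [transpose_sub, transpose_mul, Matrix.sub_mul, Matrix.mul_sub, h3, h4]
  rw [crossMat]
  simp only [Matrix.mul_assoc]
  abel

theorem sum_mul_resid (z : Fin n → ℝ) (s : State p d) :
    ∑ i, z i * resid X y s i =
      ((X * s.beta - y)ᵀ * Matrix.diagonal z * (X * s.beta - y) * s.scale⁻¹).trace := by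
  have h1 : ∀ i, s.beta.transpose.mulVec (X i) - y i = (X * s.beta - y) i := by
    intro i
    ext j
    simp [mulVec, dotProduct, mul_apply, mul_comm]
  simp only [resid, h1]
  set R := X * s.beta - y
  rw [Matrix.mul_assoc, Matrix.mul_assoc, trace_mul_comm, Matrix.mul_assoc, trace]
  refine Finset.sum_congr rfl fun i _ => ?_
  rw [diag, diagonal_mul, mul_apply]
  congr 1
  rw [dotProduct_mulVec, dotProduct]
  refine Finset.sum_congr rfl fun j _ => ?_
  simp [vecMul, dotProduct, mul_apply]

variable {X} in
theorem sum_mul_resid_eq {z : Fin n → ℝ} (hz : (crossMat X z).PosDef) (s : State p d) :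
    ∑ i, z i * resid X y s i =
      (crossMat X z * (s.beta - muMat X y z) * s.scale⁻¹ * (s.beta - muMat X y z)ᵀ).trace +
        (residMat X y z * s.scale⁻¹).trace := by
  rw [sum_mul_resid, complete_square y hz, add_mul, trace_add]
  congr 1
  rw [Matrix.mul_assoc, Matrix.mul_assoc, trace_mul_comm]
  simp only [Matrix.mul_assoc]

/-- The unnormalized joint density of `(β, Σ)` given the latent weights. -/
noncomputable def jointWeight (t : ℝ) (z : Fin n → ℝ) (s : State p d) : ℝ≥0∞ :=
  ENNReal.ofReal (s.scale.det ^ (-t) * Real.exp (-(1 / 2) * ∑ i, z i * resid X y s i))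

theorem stateMeasure_eq_prod (p d : ℕ) : stateMeasure p d =
    (volume : Measure (Fin p → Fin d → ℝ)).prod
      ((volume : Measure (SymIdx d → ℝ)).restrict {x | (symMat x).PosDef}) := by
  have h : {s : State p d | s.scale.PosDef} = univ ×ˢ {x | (symMat x).PosDef} := by
    ext s
    simp [State.scale]
  rw [stateMeasure, h, Measure.volume_eq_prod, ← Measure.prod_restrict, Measure.restrict_univ]

instance (p d : ℕ) : SigmaFinite (stateMeasure p d) := by
  rw [stateMeasure_eq_prod]
  infer_instance

theorem ae_stateMeasure_posDef (p d : ℕ) : ∀ᵐ s ∂stateMeasure p d, s.scale.PosDef :=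
  ae_restrict_mem (measurable_snd (measurableSet_symMat_posDef d))

theorem measurable_scale (i j : Fin d) : Measurable fun s : State p d => s.scale i j :=
  (measurable_symMat i j).comp measurable_snd

theorem measurable_resid (i : Fin n) : Measurable fun s : State p d => resid X y s i := by
  have h1 : ∀ k, Measurable fun s : State p d => (s.beta.transpose.mulVec (X i) - y i) k := by
    intro k
    simp only [mulVec, dotProduct, Pi.sub_apply, transpose_apply, State.beta, of_apply]
    fun_prop
  have h2 := fun k l => measurable_matrix_inv (measurable_scale (p := p) (d := d)) k l
  simp only [resid, dotProduct, mulVec]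
  refine Finset.measurable_fun_sum _ fun k _ => (h1 k).mul ?_
  exact Finset.measurable_fun_sum _ fun l _ => (h2 k l).mul (h1 l)

theorem measurable_jointWeight (t : ℝ) :
    Measurable fun q : (Fin n → ℝ) × State p d => jointWeight X y t q.1 q.2 := by
  refine ENNReal.measurable_ofReal.comp (Measurable.mul ?_ ?_)
  · exact ((measurable_matrix_det measurable_scale).comp measurable_snd).pow_const _
  · refine Real.measurable_exp.comp (Measurable.const_mul ?_ _)
    exact Finset.measurable_fun_sum _ fun i _ =>
      ((measurable_pi_apply i).comp measurable_fst).mul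
        ((measurable_resid X y i).comp measurable_snd)

variable {X y} in
-- Integrating out β multiplies by (det Σ)^{p/2} and leaves an inverse Wishart kernel in Σ.
theorem lintegral_jointWeight_beta (t : ℝ) {z : Fin n → ℝ} (hA : (crossMat X z).PosDef)
    {x : SymIdx d → ℝ} (hx : (symMat x).PosDef) :
    ∫⁻ β : Fin p → Fin d → ℝ, jointWeight X y t z (β, x) =
      (ENNReal.ofReal √(2 * Real.pi) ^ (p * d) *
        ENNReal.ofReal ((crossMat X z).det ^ (-(d / 2) : ℝ))) *
      ENNReal.ofReal ((symMat x).det ^ (-(t - p / 2)) *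
        Real.exp (-(1 / 2) * (residMat X y z * (symMat x)⁻¹).trace)) := by
  have hxd := hx.det_pos
  have hAd := hA.det_pos
  have h1 : ∀ β : Fin p → Fin d → ℝ, jointWeight X y t z (β, x) =
      ENNReal.ofReal ((symMat x).det ^ (-t) *
        Real.exp (-(1 / 2) * (residMat X y z * (symMat x)⁻¹).trace)) *
      ENNReal.ofReal (Real.exp (-(1 / 2) * (crossMat X z * (of β - muMat X y z) * (symMat x)⁻¹ *
        (of β - muMat X y z)ᵀ).trace)) := by
    intro β
    rw [← ENNReal.ofReal_mul (by positivity), jointWeight, sum_mul_resid_eq y hA, mul_assoc,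
      ← Real.exp_add]
    simp only [State.scale, State.beta]
    congr 3
    ring
  simp only [h1]
  rw [lintegral_const_mul' _ _ ENNReal.ofReal_ne_top, lintegral_matrixNormal hA hx.inv,
    mul_left_comm, mul_assoc]
  congr 1
  rw [← ENNReal.ofReal_mul (by positivity), ← ENNReal.ofReal_mul (by positivity)]
  congr 1
  rw [det_nonsing_inv, Ring.inverse_eq_inv', Real.inv_rpow hxd.le, ← Real.rpow_neg hxd.le,
    neg_neg, show -(t - p / 2) = -t + (p : ℝ) / 2 by ring, Real.rpow_add hxd]
  ring

/-- The normalizing constant of the joint density of `(β, Σ)` given the latent weights. -/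
theorem exists_lintegral_jointWeight (t : ℝ) (ht : (p : ℝ) / 2 + d < t) :
    ∃ C : ℝ≥0∞, C ≠ 0 ∧ C ≠ ∞ ∧ ∀ z : Fin n → ℝ, (crossMat X z).PosDef →
      (residMat X y z).PosDef → ∫⁻ s, jointWeight X y t z s ∂stateMeasure p d =
        C * ENNReal.ofReal ((crossMat X z).det ^ (-(d / 2) : ℝ) *
          (residMat X y z).det ^ (-(t - p / 2 - (d + 1) / 2))) := by
  obtain ⟨C, hC0, hCtop, hC⟩ := exists_lintegral_invWishart d (t - p / 2) (by linarith)
  refine ⟨ENNReal.ofReal √(2 * Real.pi) ^ (p * d) * C,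
    mul_ne_zero (gaussConst_pow_ne_zero _) hC0,
    ENNReal.mul_ne_top (gaussConst_pow_ne_top _) hCtop, fun z hA hS => ?_⟩
  have hm : Measurable (jointWeight X y t z) :=
    Measurable.of_uncurry_left (f := jointWeight X y t) (measurable_jointWeight X y t)
  rw [stateMeasure_eq_prod, lintegral_prod_symm _ hm.aemeasurable]
  have key' : ∀ᵐ x : SymIdx d → ℝ ∂volume.restrict {x | (symMat x).PosDef},
      ∫⁻ β : Fin p → Fin d → ℝ, jointWeight X y t z (β, x) = _ :=
    (ae_restrict_mem (measurableSet_symMat_posDef d)).mono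
      fun x hx => lintegral_jointWeight_beta t hA hx
  rw [lintegral_congr_ae key']
  rw [lintegral_const_mul' _ _
    (ENNReal.mul_ne_top (gaussConst_pow_ne_top _) ENNReal.ofReal_ne_top), hC _ hS,
    ENNReal.ofReal_mul (Real.rpow_nonneg hA.det_pos.le _)]
  ring

variable (a : ℝ)

/-- The conditional density of `(β, Σ)` is proportional to the joint weight, with a factor that
depends on the latent weights only. -/
theorem exists_condBeta_mul_condScale (S2 : (n : ℝ) > p + 2 * d - 2 * a) :
    ∃ c : ℝ≥0∞, c ≠ 0 ∧ c ≠ ∞ ∧ ∀ z : Fin n → ℝ, (crossMat X z).PosDef →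
      (residMat X y z).PosDef → ∀ s : State p d, s.scale.PosDef →
        condBeta X y s z * condScale a X y s z =
          c * (ENNReal.ofReal ((crossMat X z).det ^ (-(d / 2) : ℝ) *
            (residMat X y z).det ^ (-((n : ℝ) / 2 + a - p / 2 - (d + 1) / 2))))⁻¹ *
            jointWeight X y (n / 2 + a) z s := by
  set m : ℝ := (n : ℝ) - p + 2 * a - d - 1 with hm
  set G : ℝ := ∏ i ∈ Finset.Icc 1 d, Real.Gamma ((m + 1 - i) / 2) with hG
  have hGpos : 0 < G := by
    refine Finset.prod_pos fun i hi => Real.Gamma_pos_of_pos ?_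
    -- The smallest gamma argument, at i = d, is (n - p + 2a - 2d)/2, positive exactly by (S2).
    have : (i : ℝ) ≤ d := by exact_mod_cast (Finset.mem_Icc.1 hi).2
    linarith
  set b : ℝ := (2 * Real.pi) ^ ((p * d : ℝ) / 2) *
    ((2 : ℝ) ^ (m * d / 2) * Real.pi ^ ((d : ℝ) * (d - 1) / 4) * G) with hb
  have hbpos : 0 < b := by positivity
  refine ⟨ENNReal.ofReal b⁻¹, (ENNReal.ofReal_pos.2 (by positivity)).ne', ENNReal.ofReal_ne_top,
    fun z hA hS s hs => ?_⟩
  have hAd := hA.det_pos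
  have hSd := hS.det_pos
  have hsd := hs.det_pos
  have hN : 0 ≤ matrixNormalDensity (muMat X y z) (omegaMat X z) s.scale s.beta := by
    have : 0 < (omegaMat X z).det := by
      rw [omegaMat_eq]
      exact hA.inv.det_pos
    rw [matrixNormalDensity]
    positivity
  rw [condBeta, condScale, ← ENNReal.ofReal_mul hN, jointWeight,
    ← ENNReal.ofReal_inv_of_pos (by positivity), ← ENNReal.ofReal_mul (by positivity),
    ← ENNReal.ofReal_mul (by positivity)]
  congr 1
  rw [matrixNormalDensity, invWishartDensity, sum_mul_resid_eq y hA, inv_omegaMat hA,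
    nonsing_inv_nonsing_inv _ hSd.ne'.isUnit, omegaMat_eq, det_nonsing_inv, det_nonsing_inv,
    Ring.inverse_eq_inv', ← hm, ← hG, Real.inv_rpow hAd.le, Real.inv_rpow hSd.le,
    mul_add, Real.exp_add]
  -- The powers of det Σ in the two densities add up to the single power -(n/2 + a) of the joint
  -- weight.
  have e1 : s.scale.det ^ (-((n : ℝ) / 2 + a)) =
      (s.scale.det ^ ((p : ℝ) / 2))⁻¹ * s.scale.det ^ (-(m + d + 1) / 2) := by
    rw [← Real.rpow_neg hsd.le, ← Real.rpow_add hsd]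
    congr 1
    rw [hm]
    ring
  have e2 : (residMat X y z).det ^ (-((n : ℝ) / 2 + a - p / 2 - (d + 1) / 2)) =
      ((residMat X y z).det ^ (m / 2))⁻¹ := by
    rw [← Real.rpow_neg hSd.le]
    congr 1
    rw [hm]
    ring
  rw [e1, e2, Real.rpow_neg hAd.le]
  have p1 : (residMat X y z).det ^ (m / 2) ≠ 0 := by positivity
  have p2 : (crossMat X z).det ^ ((d : ℝ) / 2) ≠ 0 := by positivity
  have p3 : s.scale.det ^ ((p : ℝ) / 2) ≠ 0 := by positivity
  rw [hb]
  field_simp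

end Model

end DataAug

namespace DataAug

/-! ### The cross-product matrix of (X : y) in blocks. -/

section Blocks

open Matrix

variable {n p d : ℕ} {X : Matrix (Fin n) (Fin p) ℝ} {y : Matrix (Fin n) (Fin d) ℝ}

theorem crossMat_fromCols (X : Matrix (Fin n) (Fin p) ℝ) (y : Matrix (Fin n) (Fin d) ℝ)
    (z : Fin n → ℝ) : crossMat (fromCols X y) z =
      fromBlocks (crossMat X z) (Xᵀ * Matrix.diagonal z * y) (yᵀ * Matrix.diagonal z * X)
        (crossMat y z) := by
  rw [crossMat, transpose_fromCols, fromRows_mul, fromRows_mul_fromCols]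
  rfl

/-- The right side is a Schur complement in the cross-product matrix of (X : y), whence its
positivity and the factorization of the determinant. -/
theorem residMat_eq {z : Fin n → ℝ} (hz : (crossMat X z).PosDef) : residMat X y z =
    crossMat y z - yᵀ * Matrix.diagonal z * X * (crossMat X z)⁻¹ *
      (Xᵀ * Matrix.diagonal z * y) := by
  rw [residMat, inv_omegaMat hz, Matrix.mul_assoc _ (crossMat X z), crossMat_mul_muMat y hz, muMat,
    transpose_mul, transpose_mul, transpose_mul, omegaMat_eq, transpose_nonsing_inv,
    transpose_crossMat, diagonal_transpose, transpose_transpose]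
  simp only [crossMat, Matrix.mul_assoc]

theorem posDef_crossMat_left {z : Fin n → ℝ} (hz : (crossMat (fromCols X y) z).PosDef) :
    (crossMat X z).PosDef := by
  have h := hz.submatrix (e := Sum.inl) Sum.inl_injective
  rw [crossMat_fromCols] at h
  exact h

theorem det_crossMat_fromCols {z : Fin n → ℝ} (hz : (crossMat (fromCols X y) z).PosDef) :
    (crossMat (fromCols X y) z).det = (crossMat X z).det * (residMat X y z).det := by
  have hX := posDef_crossMat_left hz
  let _ := invertibleOfIsUnitDet _ hX.det_pos.ne'.isUnit
  rw [crossMat_fromCols, det_fromBlocks₁₁, invOf_eq_nonsing_inv, residMat_eq hX]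

theorem posDef_residMat {z : Fin n → ℝ} (hz : (crossMat (fromCols X y) z).PosDef) :
    (residMat X y z).PosDef := by
  have hX := posDef_crossMat_left hz
  let _ := invertibleOfIsUnitDet _ hX.det_pos.ne'.isUnit
  have h1 := PosDef.fromBlocks₁₁ (Xᵀ * Matrix.diagonal z * y) (crossMat y z) hX
  have h2 : (Xᵀ * Matrix.diagonal z * y)ᴴ = yᵀ * Matrix.diagonal z * X := by
    simp [transpose_mul, Matrix.mul_assoc, conjTranspose_eq_transpose_of_trivial]
  rw [h2, ← crossMat_fromCols, ← residMat_eq hX] at h1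
  refine (h1.1 hz.posSemidef).posDef_iff_det_ne_zero.2 fun h0 => ?_
  have := hz.det_pos
  rw [det_crossMat_fromCols hz, h0, mul_zero] at this
  exact lt_irrefl _ this

theorem crossMat_smul {ι κ : Type*} [Fintype ι] [DecidableEq ι] (M : Matrix ι κ ℝ) (c : ℝ)
    (z : ι → ℝ) : crossMat M (c • z) = c • crossMat M z := by
  rw [crossMat, crossMat, diagonal_smul, Matrix.mul_smul, Matrix.smul_mul]

theorem crossMat_apply {ι κ : Type*} [Fintype ι] [DecidableEq ι] (M : Matrix ι κ ℝ) (z : ι → ℝ)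
    (i j : κ) : crossMat M z i j = ∑ k, M k i * z k * M k j := by
  rw [crossMat, mul_apply]
  simp only [mul_diagonal, transpose_apply]

theorem residMat_smul {z : Fin n → ℝ} (hz : (crossMat X z).PosDef) {c : ℝ} (hc : 0 < c) :
    residMat X y (c • z) = c • residMat X y z := by
  have hz' : (crossMat X (c • z)).PosDef := by
    rw [crossMat_smul]
    exact hz.smul hc
  have hinv : (c • crossMat X z)⁻¹ = c⁻¹ • (crossMat X z)⁻¹ := by
    refine inv_eq_right_inv ?_
    rw [Matrix.smul_mul, Matrix.mul_smul, mul_nonsing_inv _ hz.det_pos.ne'.isUnit, smul_smul,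
      mul_inv_cancel₀ hc.ne', one_smul]
  rw [residMat_eq hz, residMat_eq hz', crossMat_smul, crossMat_smul, hinv, diagonal_smul]
  simp only [Matrix.mul_smul, Matrix.smul_mul, smul_smul, smul_sub]
  congr 2
  field_simp

theorem injective_mulVec_of_rank {ι κ : Type*} [Fintype ι] [Fintype κ] {M : Matrix ι κ ℝ}
    (hM : M.rank = Fintype.card κ) : Function.Injective M.mulVec := by
  have h1 := LinearMap.finrank_range_add_finrank_ker M.mulVecLin
  rw [← Matrix.rank, hM, Module.finrank_fintype_fun_eq_card] at h1
  have h2 : Module.finrank ℝ (LinearMap.ker M.mulVecLin) = 0 := by omega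
  exact LinearMap.ker_eq_bot.1 (Submodule.finrank_eq_zero.1 h2)

theorem posDef_crossMat {ι κ : Type*} [Fintype ι] [DecidableEq ι] [Fintype κ] {M : Matrix ι κ ℝ}
    (hM : M.rank = Fintype.card κ) {z : ι → ℝ} (hz : ∀ i, 0 < z i) : (crossMat M z).PosDef := by
  have h := (posDef_diagonal_iff.2 hz).conjTranspose_mul_mul_same (injective_mulVec_of_rank hM)
  rwa [conjTranspose_eq_transpose_of_trivial] at h

end Blocks

/-! ### Bounds on determinants through selected rows. -/

section RowSelection

open Matrix

theorem exists_rows_det_ne_zero {ι κ : Type*} [Fintype ι] [Fintype κ] [DecidableEq κ]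
    {M : Matrix ι κ ℝ} (hM : M.rank = Fintype.card κ) :
    ∃ e : κ → ι, Function.Injective e ∧ (M.submatrix e id).det ≠ 0 := by
  obtain ⟨κ', b, hb, hspan, hli⟩ := exists_linearIndependent' ℝ M.row
  have : Finite κ' := Finite.of_injective b hb
  have := Fintype.ofFinite κ'
  have hcard : Fintype.card κ' = Fintype.card κ := by
    rw [← hM, rank_eq_finrank_span_row, ← hspan, finrank_span_eq_card hli]
  let f : κ ≃ κ' := Fintype.equivOfCardEq hcard.symm
  refine ⟨b ∘ f, hb.comp f.injective, ?_⟩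
  have h2 : LinearIndependent ℝ (M.submatrix (b ∘ f) id).row :=
    hli.comp f f.injective
  exact ((isUnit_iff_isUnit_det _).1 (linearIndependent_rows_iff_isUnit.1 h2)).ne_zero

/-- Setting weights to zero amounts to deleting rows, so row selection can be expressed as a change
of weights. -/
theorem crossMat_indicator {ι κ l : Type*} [Fintype ι] [DecidableEq ι] [Fintype l] [DecidableEq l]
    (M : Matrix ι κ ℝ) {e : l → ι} (he : Function.Injective e) (z : ι → ℝ) :
    crossMat M (indicator (range e) z) = crossMat (M.submatrix e id) (z ∘ e) := by
  ext i j
  simp only [crossMat_apply, submatrix_apply, id]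
  refine (Fintype.sum_of_injective e he _ _ (fun k hk => ?_) fun k => ?_).symm
  · simp [indicator_of_notMem hk]
  · simp

theorem det_crossMat_square {κ : Type*} [Fintype κ] [DecidableEq κ] (M : Matrix κ κ ℝ)
    (z : κ → ℝ) : (crossMat M z).det = M.det ^ 2 * ∏ i, z i := by
  rw [crossMat, det_mul, det_mul, det_transpose, det_diagonal]
  ring

theorem quadForm_crossMat {ι κ : Type*} [Fintype ι] [DecidableEq ι] [Fintype κ]
    (M : Matrix ι κ ℝ) (z : ι → ℝ) (x : κ → ℝ) :
    x ⬝ᵥ crossMat M z *ᵥ x = ∑ i, z i * (M *ᵥ x) i ^ 2 := by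
  rw [crossMat, ← mulVec_mulVec, ← mulVec_mulVec, dotProduct_mulVec, vecMul_transpose, dotProduct]
  refine Finset.sum_congr rfl fun i _ => ?_
  rw [mulVec_diagonal]
  ring

/-- Each row is a combination of rows of M, and the determinant is multilinear in rows. This is
Cauchy–Binet before grouping the maps g by their range. -/
theorem det_crossMat_eq_sum {ι κ : Type*} [Fintype ι] [DecidableEq ι] [Fintype κ]
    [DecidableEq κ] (M : Matrix ι κ ℝ) (z : ι → ℝ) :
    (crossMat M z).det = ∑ g : κ → ι,
      ((∏ j, M (g j) j) * (M.submatrix g id).det) * ∏ j, z (g j) := by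
  have h1 : crossMat M z = of fun k => ∑ i, (M i k * z i) • M i := by
    ext k l
    simp only [crossMat_apply, of_apply, Finset.sum_apply, Pi.smul_apply, smul_eq_mul]
  rw [h1]
  change detRowAlternating (fun k => ∑ i, (M i k * z i) • M i) = _
  have h2 := (detRowAlternating (R := ℝ) (n := κ)).toMultilinearMap.map_sum
    (fun k i => (M i k * z i) • M i)
  refine h2.trans (Finset.sum_congr rfl fun g _ => ?_)
  have h3 := (detRowAlternating (R := ℝ) (n := κ)).toMultilinearMap.map_smul_univ
    (fun k => M (g k) k * z (g k)) (fun k => M (g k))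
  refine h3.trans ?_
  rw [Finset.prod_mul_distrib, smul_eq_mul]
  change _ * (M.submatrix g id).det = _
  ring

theorem det_crossMat_ge {ι κ : Type*} [Fintype ι] [DecidableEq ι] [Fintype κ]
    [DecidableEq κ] {M : Matrix ι κ ℝ} (hM : M.rank = Fintype.card κ) {g : κ → ι}
    (hg : Function.Injective g) (hdet : (M.submatrix g id).det ≠ 0) {z : ι → ℝ}
    (hz : ∀ i, 0 < z i) :
    (M.submatrix g id).det ^ 2 * ∏ j, z (g j) ≤ (crossMat M z).det := by
  have h1 := det_crossMat_square (M.submatrix g id) (z ∘ g)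
  simp only [Function.comp_apply] at h1
  rw [← h1]
  refine det_le_det_of_quadForm_le (posDef_crossMat (rank_of_det_ne_zero hdet) fun i => hz _)
    (posDef_crossMat hM hz) fun x => ?_
  rw [← crossMat_indicator M hg, quadForm_crossMat, quadForm_crossMat]
  refine Finset.sum_le_sum fun i _ => ?_
  refine mul_le_mul_of_nonneg_right ?_ (sq_nonneg _)
  exact indicator_le_self' (fun _ _ => (hz _).le) i

theorem rpow_sum_le_card_mul_sum {α : Type*} (s : Finset α) {b : α → ℝ} (hb : ∀ i ∈ s, 0 ≤ b i)
    {r : ℝ} (hr : 0 ≤ r) (hs : s.Nonempty) :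
    (∑ i ∈ s, b i) ^ r ≤ (s.card : ℝ) ^ r * ∑ i ∈ s, b i ^ r := by
  obtain ⟨i0, hi0, hmax⟩ := s.exists_max_image b hs
  calc (∑ i ∈ s, b i) ^ r ≤ (s.card * b i0) ^ r := by
        refine Real.rpow_le_rpow (Finset.sum_nonneg hb) ?_ hr
        simpa using Finset.sum_le_card_nsmul s b (b i0) hmax
    _ = (s.card : ℝ) ^ r * b i0 ^ r := Real.mul_rpow (by positivity) (hb _ hi0)
    _ ≤ _ := by
        gcongr
        exact Finset.single_le_sum (f := fun i => b i ^ r)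
          (fun i hi => Real.rpow_nonneg (hb i hi) r) hi0

/-- Any real power of `det (Mᵀ diag(z) M)` is bounded by a combination of the corresponding powers
of products of distinct weights. -/
theorem exists_det_crossMat_rpow_le {ι κ : Type*} [Fintype ι] [DecidableEq ι] [Fintype κ]
    [DecidableEq κ] {M : Matrix ι κ ℝ} (hM : M.rank = Fintype.card κ) (r : ℝ) :
    ∃ (T : Finset (κ → ι)) (c : ℝ), 0 ≤ c ∧ (∀ g ∈ T, Function.Injective g) ∧
      ∀ z : ι → ℝ, (∀ i, 0 < z i) →
        (crossMat M z).det ^ r ≤ c * ∑ g ∈ T, ∏ j, z (g j) ^ r := by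
  classical
  obtain ⟨e, he, hdet⟩ := exists_rows_det_ne_zero hM
  -- For r ≥ 0 the expansion is used, where non-injective maps repeat a row and drop out. For r < 0
  -- a single nonzero minor bounds the determinant below, and the power reverses the inequality.
  rcases le_or_gt 0 r with hr | hr
  · set T : Finset (κ → ι) := Finset.univ.filter Function.Injective with hT
    have hTne : T.Nonempty := ⟨e, by simpa [hT] using he⟩
    set b : (κ → ι) → ℝ := fun g => |(∏ j, M (g j) j) * (M.submatrix g id).det|
    set B : ℝ := ∑ g ∈ T, b g with hB
    have hB0 : 0 ≤ B := Finset.sum_nonneg fun g _ => abs_nonneg _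
    refine ⟨T, B ^ r * (T.card : ℝ) ^ r, by positivity, fun g hg => by simpa [hT] using hg,
      fun z hz => ?_⟩
    have hpos : ∀ g : κ → ι, 0 ≤ ∏ j, z (g j) := fun g => Finset.prod_nonneg fun j _ => (hz _).le
    have h1 : (crossMat M z).det ≤ B * ∑ g ∈ T, ∏ j, z (g j) := by
      rw [det_crossMat_eq_sum, ← Finset.sum_subset (Finset.subset_univ T), Finset.mul_sum]
      · refine Finset.sum_le_sum fun g hg => mul_le_mul_of_nonneg_right ?_ (hpos g)
        exact (le_abs_self _).trans
          (Finset.single_le_sum (f := b) (fun g _ => abs_nonneg _) hg)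
      · intro g _ hg
        have hg' : ¬ Function.Injective g := by simpa [hT] using hg
        rw [Function.not_injective_iff] at hg'
        obtain ⟨i, j, hij, hne⟩ := hg'
        rw [det_zero_of_row_eq hne (by ext k; simp [hij]), mul_zero, zero_mul]
    calc (crossMat M z).det ^ r ≤ (B * ∑ g ∈ T, ∏ j, z (g j)) ^ r :=
          Real.rpow_le_rpow (posDef_crossMat hM hz).det_pos.le h1 hr
      _ = B ^ r * (∑ g ∈ T, ∏ j, z (g j)) ^ r :=
          Real.mul_rpow hB0 (Finset.sum_nonneg fun g _ => hpos g)
      _ ≤ B ^ r * ((T.card : ℝ) ^ r * ∑ g ∈ T, (∏ j, z (g j)) ^ r) := by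
          gcongr
          exact rpow_sum_le_card_mul_sum T (fun g _ => hpos g) hr hTne
      _ = B ^ r * (T.card : ℝ) ^ r * ∑ g ∈ T, ∏ j, z (g j) ^ r := by
          rw [← mul_assoc]
          congr 1
          exact Finset.sum_congr rfl fun g _ =>
            (Real.finsetProd_rpow _ _ (fun j _ => (hz _).le) r).symm
  · refine ⟨{e}, ((M.submatrix e id).det ^ 2) ^ r, by positivity, by simpa using he,
      fun z hz => ?_⟩
    have hp : 0 < ∏ j, z (e j) := Finset.prod_pos fun j _ => hz _
    have h2 : 0 < (M.submatrix e id).det ^ 2 := by positivity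
    rw [Finset.sum_singleton, Real.finsetProd_rpow _ _ (fun j _ => (hz _).le), ← Real.mul_rpow
      h2.le hp.le]
    exact Real.rpow_le_rpow_of_nonpos (by positivity) (det_crossMat_ge hM he hdet hz) hr.le

end RowSelection

end DataAug

namespace DataAug

noncomputable section

/-! ### Integration over the positive orthant. -/

section PositiveOrthant

theorem restrict_posOrthant (n : ℕ) :
    (volume : Measure (Fin n → ℝ)).restrict {z | ∀ i, 0 < z i} =
      Measure.pi fun _ => (volume : Measure ℝ).restrict (Ioi 0) := by
  have h : {z : Fin n → ℝ | ∀ i, 0 < z i} = univ.pi fun _ => Ioi 0 := by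
    ext z
    simp [Set.mem_pi]
  rw [h, volume_pi, Measure.restrict_pi_pi]

theorem measurableSet_posOrthant (n : ℕ) : MeasurableSet {z : Fin n → ℝ | ∀ i, 0 < z i} := by
  have h : {z : Fin n → ℝ | ∀ i, 0 < z i} = univ.pi fun _ => Ioi 0 := by
    ext z
    simp [Set.mem_pi]
  rw [h]
  exact MeasurableSet.univ_pi fun _ => measurableSet_Ioi

theorem lintegral_posOrthant_prod {n : ℕ} {φ : Fin n → ℝ → ℝ≥0∞} (hφ : ∀ i, Measurable (φ i)) :
    ∫⁻ z in {z : Fin n → ℝ | ∀ i, 0 < z i}, ∏ i, φ i (z i) =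
      ∏ i, ∫⁻ u in Ioi (0 : ℝ), φ i u := by
  rw [restrict_posOrthant, lintegral_fintype_prod_eq_prod _ hφ]

end PositiveOrthant

/-! ### The mixing density near the origin and the bound on ψ. -/

section MixingDensity

variable {h : ℝ → ℝ≥0} {d : ℕ}

/-- The Laplace transform of `u^{d/2} h(u)` at `r / 2`. -/
def laplaceMix (h : ℝ → ℝ≥0) (d : ℕ) (r : ℝ) : ℝ≥0∞ :=
  ∫⁻ u in Ioi (0 : ℝ),
    ENNReal.ofReal (u ^ ((d : ℝ) / 2) * Real.exp (-(r * u) / 2)) * (h u : ℝ≥0∞)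

/-- The mass that `u^{d/2} h(u)` puts on `(0, x)`. -/
def mixMass (h : ℝ → ℝ≥0) (d : ℕ) (x : ℝ) : ℝ≥0∞ :=
  ∫⁻ v in Ioo (0 : ℝ) x, ENNReal.ofReal (v ^ ((d : ℝ) / 2)) * (h v : ℝ≥0∞)

/-- The unnormalized density of the latent weights. -/
def mixWeight {n : ℕ} (h : ℝ → ℝ≥0) (d : ℕ) (z : Fin n → ℝ) : ℝ≥0∞ :=
  ∏ i, (ENNReal.ofReal (z i ^ ((d : ℝ) / 2)) * (h (z i) : ℝ≥0∞))

theorem measurable_mixWeight {n : ℕ} (hh : Measurable h) :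
    Measurable (mixWeight (n := n) h d) :=
  Finset.measurable_fun_prod _ fun i _ => (ENNReal.measurable_ofReal.comp
    ((measurable_pi_apply i).pow_const _)).mul (hh.comp (measurable_pi_apply i)).coe_nnreal_ennreal

theorem mixMass_pos (hh : Measurable h) (hpos : ∃ ε > (0 : ℝ), ∀ u ∈ Ioo 0 ε, 0 < h u)
    {x : ℝ} (hx : 0 < x) : 0 < mixMass h d x := by
  obtain ⟨ε, hε, hpos⟩ := hpos
  have hm : Measurable fun v : ℝ => ENNReal.ofReal (v ^ ((d : ℝ) / 2)) * (h v : ℝ≥0∞) := by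
    fun_prop
  rw [mixMass, setLIntegral_pos_iff hm]
  refine lt_of_lt_of_le ?_ (measure_mono (s := Ioo 0 (min ε x)) fun v hv => ⟨?_, ?_⟩)
  · simp [hε, hx]
  · have h1 : 0 < v := hv.1
    have h2 := hpos v ⟨hv.1, hv.2.trans_le (min_le_left _ _)⟩
    have h3 : 0 < v ^ ((d : ℝ) / 2) := by positivity
    simp [h2.ne', h3]
  · exact ⟨hv.1, hv.2.trans_le (min_le_right _ _)⟩

theorem mixMass_mono : Monotone (mixMass h d) := fun _ _ hxy =>
  lintegral_mono_set (Ioo_subset_Ioo_right hxy)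

/-- The Laplace transform is bounded below by the mass near the origin. -/
theorem le_laplaceMix {r : ℝ} (hr : 0 ≤ r) (x : ℝ) :
    ENNReal.ofReal (Real.exp (-(r * x) / 2)) * mixMass h d x ≤ laplaceMix h d r := by
  rw [laplaceMix, mixMass, ← lintegral_const_mul' _ _ ENNReal.ofReal_ne_top]
  refine (setLIntegral_mono' measurableSet_Ioo fun v hv => ?_).trans
    (lintegral_mono_set (Ioo_subset_Ioi_self))
  have hv0 : (0 : ℝ) < v := hv.1
  rw [← mul_assoc, ← ENNReal.ofReal_mul (Real.exp_pos _).le, mul_comm (Real.exp _)]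
  gcongr
  exact hv.2.le

theorem laplaceMix_pos (hh : Measurable h) (hpos : ∃ ε > (0 : ℝ), ∀ u ∈ Ioo 0 ε, 0 < h u)
    {r : ℝ} (hr : 0 ≤ r) : 0 < laplaceMix h d r :=
  lt_of_lt_of_le (ENNReal.mul_pos (ENNReal.ofReal_pos.2 (Real.exp_pos _)).ne'
    (mixMass_pos hh hpos one_pos).ne') (le_laplaceMix hr 1)

theorem laplaceMix_ne_top
    (S3 : ∫⁻ u in Ioi (0 : ℝ), ENNReal.ofReal (u ^ ((d : ℝ) / 2)) * (h u : ℝ≥0∞) < ∞)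
    {r : ℝ} (hr : 0 ≤ r) : laplaceMix h d r ≠ ∞ := by
  refine (lt_of_le_of_lt (setLIntegral_mono' measurableSet_Ioi fun u hu => ?_) S3).ne
  have hu0 : (0 : ℝ) < u := hu
  gcongr
  refine mul_le_of_le_one_right (by positivity) (Real.exp_le_one_iff.2 ?_)
  have : 0 ≤ r * u := by positivity
  linarith

/-- The integrand of the hypothesis on the behaviour of `h` at the origin. -/
def mixRatio (h : ℝ → ℝ≥0) (d : ℕ) (ζ u : ℝ) : ℝ≥0∞ :=
  ENNReal.ofReal (u ^ ((d : ℝ) / 2)) * (h u : ℝ≥0∞) / mixMass h d (ζ * u)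

theorem measurable_mixRatio (hh : Measurable h) {ζ : ℝ} (hζ : 0 ≤ ζ) :
    Measurable (mixRatio h d ζ) := by
  have h1 : Measurable fun u => mixMass h d (ζ * u) :=
    Monotone.measurable fun a b hab => mixMass_mono (mul_le_mul_of_nonneg_left hab hζ)
  unfold mixRatio
  fun_prop

/-- For u ≥ η one has ζu ≥ η, so the denominator is at least the positive constant `mixMass h d η`
and (S3) controls the tail. -/
theorem lintegral_mixRatio_lt_top (hh : Measurable h)
    (hpos : ∃ ε > (0 : ℝ), ∀ u ∈ Ioo 0 ε, 0 < h u)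
    (S3 : ∫⁻ u in Ioi (0 : ℝ), ENNReal.ofReal (u ^ ((d : ℝ) / 2)) * (h u : ℝ≥0∞) < ∞)
    {ζ η : ℝ} (hζ : 1 < ζ) (hη : 0 < η) (hint : ∫⁻ u in Ioo (0 : ℝ) η, mixRatio h d ζ u < ∞) :
    ∫⁻ u in Ioi (0 : ℝ), mixRatio h d ζ u < ∞ := by
  rw [← Ioo_union_Ici_eq_Ioi hη]
  refine (lintegral_union_le _ _ _).trans_lt (ENNReal.add_lt_top.2 ⟨hint, ?_⟩)
  have h1 : ∀ u ∈ Ici η, mixRatio h d ζ u ≤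
      (mixMass h d η)⁻¹ * (ENNReal.ofReal (u ^ ((d : ℝ) / 2)) * (h u : ℝ≥0∞)) := by
    intro u hu
    have hu' : η ≤ u := hu
    rw [mixRatio, ENNReal.div_eq_inv_mul]
    gcongr
    exact mixMass_mono (by nlinarith)
  refine (setLIntegral_mono' measurableSet_Ici h1).trans_lt ?_
  have hne : (mixMass h d η)⁻¹ ≠ ∞ := ENNReal.inv_ne_top.2 (mixMass_pos hh hpos hη).ne'
  rw [lintegral_const_mul' _ _ hne]
  exact ENNReal.mul_lt_top hne.lt_top ((lintegral_mono_set (Ici_subset_Ioi.2 hη)).trans_lt S3)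

theorem psi_eq (u r : ℝ) : psi h d u r =
    ENNReal.ofReal (u ^ ((d : ℝ) / 2) * Real.exp (-(r * u) / 2)) * (h u : ℝ≥0∞) /
      laplaceMix h d r := rfl

/-- Bounding the normalizing integral below by its part over (0, ζu) separates u from r, up to an
exponential growth that the joint weight can absorb when ζ < 2. -/
theorem psi_le {u r ζ : ℝ} (hu : 0 < u) (hr : 0 ≤ r) :
    psi h d u r ≤ mixRatio h d ζ u * ENNReal.ofReal (Real.exp ((ζ - 1) / 2 * (u * r))) := by
  have h1 : ENNReal.ofReal (Real.exp (-(r * (ζ * u)) / 2)) ≠ 0 :=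
    (ENNReal.ofReal_pos.2 (Real.exp_pos _)).ne'
  calc psi h d u r ≤ ENNReal.ofReal (u ^ ((d : ℝ) / 2) * Real.exp (-(r * u) / 2)) * (h u : ℝ≥0∞) /
        (ENNReal.ofReal (Real.exp (-(r * (ζ * u)) / 2)) * mixMass h d (ζ * u)) := by
        rw [psi_eq]
        gcongr
        exact le_laplaceMix hr _
    _ = _ := by
        have h2 : ENNReal.ofReal (u ^ ((d : ℝ) / 2) * Real.exp (-(r * u) / 2)) =
            ENNReal.ofReal (u ^ ((d : ℝ) / 2)) *
              ENNReal.ofReal (Real.exp ((ζ - 1) / 2 * (u * r))) *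
              ENNReal.ofReal (Real.exp (-(r * (ζ * u)) / 2)) := by
          rw [← ENNReal.ofReal_mul (by positivity), ← ENNReal.ofReal_mul (by positivity),
            mul_assoc, ← Real.exp_add]
          congr 3
          ring
        rw [h2, mixRatio, mul_right_comm, mul_comm (ENNReal.ofReal (Real.exp (-(r * (ζ * u)) / 2))),
          ENNReal.mul_div_mul_right _ _ h1 ENNReal.ofReal_ne_top, ENNReal.div_eq_inv_mul,
          ENNReal.div_eq_inv_mul]
        ring

end MixingDensity

section Resid

open Matrix

variable {n p d : ℕ} (X : Matrix (Fin n) (Fin p) ℝ) (y : Matrix (Fin n) (Fin d) ℝ)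

theorem resid_nonneg {s : State p d} (hs : s.scale.PosDef) (i : Fin n) : 0 ≤ resid X y s i := by
  have h := hs.inv.posSemidef.dotProduct_mulVec_nonneg (s.beta.transpose.mulVec (X i) - y i)
  rwa [star_trivial] at h

/-- Allows weights to be replaced by zero, that is, observations to be dropped, in an upper bound.
-/
theorem jointWeight_anti (t : ℝ) {s : State p d} (hs : s.scale.PosDef) {z z' : Fin n → ℝ}
    (hz : z' ≤ z) : jointWeight X y t z s ≤ jointWeight X y t z' s := by
  have h1 : ∑ i, z' i * resid X y s i ≤ ∑ i, z i * resid X y s i :=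
    Finset.sum_le_sum fun i _ => mul_le_mul_of_nonneg_right (hz i) (resid_nonneg X y hs i)
  refine ENNReal.ofReal_le_ofReal (mul_le_mul_of_nonneg_left (Real.exp_le_exp.2 ?_)
    (Real.rpow_nonneg hs.det_pos.le _))
  linarith

end Resid

end

end DataAug

namespace DataAug

noncomputable section

/-! ### Propriety of the posterior. -/

section Propriety

open Matrix

variable {n p d : ℕ} (X : Matrix (Fin n) (Fin p) ℝ) (y : Matrix (Fin n) (Fin d) ℝ)

/-- The dependence of the normalizing constant of the joint weight on the latent weights. -/
def normFactor (t : ℝ) (z : Fin n → ℝ) : ℝ≥0∞ :=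
  ENNReal.ofReal ((crossMat X z).det ^ (-(d / 2) : ℝ) *
    (residMat X y z).det ^ (-(t - p / 2 - (d + 1) / 2)))

theorem measurable_normFactor (t : ℝ) : Measurable (normFactor X y t) := by
  have h1 : ∀ {κ κ' : Type} (M : Matrix (Fin n) κ ℝ) (M' : Matrix (Fin n) κ' ℝ) (i : κ) (j : κ'),
      Measurable fun z : Fin n → ℝ => (Mᵀ * Matrix.diagonal z * M') i j := by
    intro κ κ' M M' i j
    have : (fun z : Fin n → ℝ => (Mᵀ * Matrix.diagonal z * M') i j) =
        fun z => ∑ k, M k i * z k * M' k j := by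
      funext z
      rw [mul_apply]
      simp only [mul_diagonal, transpose_apply]
    rw [this]
    fun_prop
  have hX : ∀ i j, Measurable fun z : Fin n → ℝ => crossMat X z i j := h1 X X
  have hmu : ∀ i j, Measurable fun z : Fin n → ℝ => muMat X y z i j := by
    intro i j
    have : (fun z : Fin n → ℝ => muMat X y z i j) =
        fun z => ∑ k, (crossMat X z)⁻¹ i k * (Xᵀ * Matrix.diagonal z * y) k j := by
      funext z
      rw [muMat, omegaMat_eq, Matrix.mul_assoc, Matrix.mul_assoc, ← Matrix.mul_assoc Xᵀ, mul_apply]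
    rw [this]
    exact Finset.measurable_fun_sum _ fun k _ => (measurable_matrix_inv hX i k).mul (h1 X y k j)
  have hS : ∀ i j, Measurable fun z : Fin n → ℝ => residMat X y z i j := by
    intro i j
    simp only [residMat, Matrix.sub_apply]
    refine (h1 y y i j).sub ?_
    simp only [mul_apply, transpose_apply]
    exact Finset.measurable_fun_sum _ fun k _ => (Finset.measurable_fun_sum _ fun l _ =>
      (hmu l i).mul (measurable_matrix_inv (fun i j => measurable_matrix_inv hX i j) l k)).mul
        (hmu k j)
  exact ENNReal.measurable_ofReal.comp (((measurable_matrix_det hX).pow_const _).mul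
    ((measurable_matrix_det hS).pow_const _))

variable {X y}

theorem normFactor_ne_zero {t : ℝ} {z : Fin n → ℝ} (hX : (crossMat X z).PosDef)
    (hS : (residMat X y z).PosDef) : normFactor X y t z ≠ 0 :=
  (ENNReal.ofReal_pos.2 (mul_pos (Real.rpow_pos_of_pos hX.det_pos _)
    (Real.rpow_pos_of_pos hS.det_pos _))).ne'

/-- The two determinants are homogeneous in z of degrees p and d. -/
theorem normFactor_smul (t : ℝ) {c : ℝ} (hc : 0 < c) : ∃ b : ℝ≥0∞, b ≠ ∞ ∧
    ∀ z : Fin n → ℝ, (crossMat X z).PosDef → (residMat X y z).PosDef →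
      normFactor X y t (c • z) = b * normFactor X y t z := by
  refine ⟨ENNReal.ofReal ((c ^ p) ^ (-(d / 2) : ℝ) * (c ^ d) ^ (-(t - p / 2 - (d + 1) / 2))),
    ENNReal.ofReal_ne_top, fun z hX hS => ?_⟩
  rw [normFactor, normFactor, ← ENNReal.ofReal_mul (by positivity), crossMat_smul,
    residMat_smul hX hc, det_smul, det_smul, Fintype.card_fin, Fintype.card_fin,
    Real.mul_rpow (by positivity) hX.det_pos.le, Real.mul_rpow (by positivity) hS.det_pos.le]
  congr 1
  ring

theorem posDef_crossMat_of_rank (S1 : (fromCols X y).rank = p + d) {z : Fin n → ℝ}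
    (hz : ∀ i, 0 < z i) : (crossMat (fromCols X y) z).PosDef :=
  posDef_crossMat (by simpa using S1) hz

/-- A bound for the normalizing constant by products of powers of the weights of `p + d` rows. -/
theorem exists_lintegral_jointWeight_le (S1 : (fromCols X y).rank = p + d) (t : ℝ)
    (ht : (p : ℝ) / 2 + d < t) :
    ∃ (e : Fin p ⊕ Fin d → Fin n) (T : Finset (Fin p → Fin p ⊕ Fin d)) (C : ℝ≥0∞),
      Function.Injective e ∧ C ≠ ∞ ∧ (∀ g ∈ T, Function.Injective g) ∧
      ∀ z : Fin n → ℝ, (∀ i, 0 < z i) → ∫⁻ s, jointWeight X y t z s ∂stateMeasure p d ≤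
        C * ∑ g ∈ T, ENNReal.ofReal ((∏ j, z (e (g j)) ^ (t - p / 2 - (d + 1) / 2 - d / 2)) *
          ∏ l, z (e l) ^ (-(t - p / 2 - (d + 1) / 2))) := by
  set k : ℝ := t - p / 2 - (d + 1) / 2 with hk
  have hrank : (fromCols X y).rank = Fintype.card (Fin p ⊕ Fin d) := by simpa using S1
  obtain ⟨e, he, hdet⟩ := exists_rows_det_ne_zero hrank
  set Me := (fromCols X y).submatrix e id with hMe
  have hXe : (X.submatrix e id).rank = Fintype.card (Fin p) := by
    have h1 : (crossMat Me 1).PosDef :=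
      posDef_crossMat (rank_of_det_ne_zero hdet) fun _ => one_pos
    have h2 := h1.submatrix (e := Sum.inl) Sum.inl_injective
    have h3 : (crossMat Me 1).submatrix Sum.inl Sum.inl =
        (X.submatrix e id)ᵀ * X.submatrix e id := by
      ext i j
      rw [submatrix_apply, crossMat_apply, mul_apply]
      simp [hMe]
    rw [h3] at h2
    rw [← rank_transpose_mul_self, rank_of_det_ne_zero h2.det_pos.ne']
  obtain ⟨T, c, hc, hT, hbound⟩ := exists_det_crossMat_rpow_le hXe (k - d / 2)
  obtain ⟨C, -, hCtop, hC⟩ := exists_lintegral_jointWeight X y t ht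
  refine ⟨e, T, C * ENNReal.ofReal (c * (Me.det ^ 2) ^ (-k)), he,
    ENNReal.mul_ne_top hCtop ENNReal.ofReal_ne_top, hT, fun z hz => ?_⟩
  set z' : Fin n → ℝ := indicator (range e) z with hz'
  have hle : z' ≤ z := fun i => indicator_le_self' (fun _ _ => (hz _).le) i
  have hW : crossMat (fromCols X y) z' = crossMat Me (z ∘ e) := crossMat_indicator _ he z
  have hA : crossMat X z' = crossMat (X.submatrix e id) (z ∘ e) := crossMat_indicator _ he z
  have hWpos : (crossMat (fromCols X y) z').PosDef := by
    rw [hW]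
    exact posDef_crossMat (rank_of_det_ne_zero hdet) fun _ => hz _
  have hApos := posDef_crossMat_left hWpos
  have hSpos := posDef_residMat hWpos
  have hprod : 0 < ∏ l, z (e l) := Finset.prod_pos fun l _ => hz _
  have hD : 0 < Me.det ^ 2 := by positivity
  have hdetS : Me.det ^ 2 * ∏ l, z (e l) = (crossMat X z').det * (residMat X y z').det := by
    rw [← det_crossMat_fromCols hWpos, hW, det_crossMat_square]
    rfl
  have hAd := hApos.det_pos
  have hSd := hSpos.det_pos
  -- The residual determinant is eliminated: its product with the determinant for X is the monomial
  -- `Me.det ^ 2 * ∏ l, z (e l)`.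
  have heq : (crossMat X z').det ^ (-(d / 2) : ℝ) * (residMat X y z').det ^ (-k) =
      (crossMat X z').det ^ (k - d / 2) * ((Me.det ^ 2) ^ (-k) * ∏ l, z (e l) ^ (-k)) := by
    rw [Real.finsetProd_rpow _ _ (fun l _ => (hz _).le), ← Real.mul_rpow hD.le hprod.le, hdetS,
      Real.mul_rpow hAd.le hSd.le, ← mul_assoc, ← Real.rpow_add hAd]
    congr 2
    ring
  have hfin := hbound (z ∘ e) fun _ => hz _
  rw [← hA] at hfin
  have hnn : ∀ g : Fin p → Fin p ⊕ Fin d,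
      0 ≤ (∏ j, z (e (g j)) ^ (k - d / 2)) * ∏ l, z (e l) ^ (-k) := fun g =>
    mul_nonneg (Finset.prod_nonneg fun _ _ => Real.rpow_nonneg (hz _).le _)
      (Finset.prod_nonneg fun _ _ => Real.rpow_nonneg (hz _).le _)
  calc ∫⁻ s, jointWeight X y t z s ∂stateMeasure p d
      ≤ ∫⁻ s, jointWeight X y t z' s ∂stateMeasure p d :=
        lintegral_mono_ae ((ae_stateMeasure_posDef p d).mono fun s hs =>
          jointWeight_anti X y t hs hle)
    _ = C * ENNReal.ofReal ((crossMat X z').det ^ (k - d / 2) *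
          ((Me.det ^ 2) ^ (-k) * ∏ l, z (e l) ^ (-k))) := by
        rw [hC z' hApos hSpos, heq]
    _ ≤ C * ENNReal.ofReal ((c * (Me.det ^ 2) ^ (-k)) *
          ∑ g ∈ T, (∏ j, z (e (g j)) ^ (k - d / 2)) * ∏ l, z (e l) ^ (-k)) := by
        gcongr C * ENNReal.ofReal ?_
        rw [← Finset.sum_mul]
        calc _ ≤ (c * ∑ g ∈ T, ∏ j, (z ∘ e) (g j) ^ (k - d / 2)) *
              ((Me.det ^ 2) ^ (-k) * ∏ l, z (e l) ^ (-k)) :=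
              mul_le_mul_of_nonneg_right hfin (mul_nonneg (Real.rpow_nonneg hD.le _)
                (Finset.prod_nonneg fun _ _ => Real.rpow_nonneg (hz _).le _))
          _ = _ := by
              simp only [Function.comp_apply]
              ring
    _ = _ := by
        rw [ENNReal.ofReal_mul (mul_nonneg hc (Real.rpow_nonneg hD.le _)),
          ENNReal.ofReal_sum_of_nonneg fun g _ => hnn g, mul_assoc]

/-- Propriety: the joint weight is integrable in all variables. -/
theorem lintegral_mixWeight_mul_lt_top {h : ℝ → ℝ≥0} (hh : IsMixingDensity h) (a : ℝ)
    (S1 : (fromCols X y).rank = p + d) (S2 : (n : ℝ) > p + 2 * d - 2 * a)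
    (S3 : ∫⁻ u in Ioi (0 : ℝ), ENNReal.ofReal (u ^ ((d : ℝ) / 2)) * (h u : ℝ≥0∞) < ∞)
    (S4 : ∫⁻ u in Ioi (0 : ℝ),
      ENNReal.ofReal (u ^ (-((n : ℝ) - p + 2 * a - 2 * d - 1) / 2)) * (h u : ℝ≥0∞) < ∞) :
    ∫⁻ z in {z : Fin n → ℝ | ∀ i, 0 < z i}, mixWeight h d z *
      ∫⁻ s, jointWeight X y (n / 2 + a) z s ∂stateMeasure p d < ∞ := by
  classical
  obtain ⟨e, T, C, he, hC, hT, hbound⟩ :=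
    exists_lintegral_jointWeight_le S1 ((n : ℝ) / 2 + a) (by linarith)
  set k : ℝ := (n : ℝ) / 2 + a - p / 2 - (d + 1) / 2 with hk
  set r : ℝ := k - d / 2 with hr
  let φ : (Fin p → Fin p ⊕ Fin d) → Fin n → ℝ → ℝ≥0∞ := fun g i u =>
    (ENNReal.ofReal (u ^ ((d : ℝ) / 2)) * (h u : ℝ≥0∞)) *
      ENNReal.ofReal ((if i ∈ range (e ∘ g) then u ^ r else 1) *
        (if i ∈ range e then u ^ (-k) else 1))
  have hhm := hh.measurable
  have hφ : ∀ g i, Measurable (φ g i) := by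
    intro g i
    have h1 : Measurable fun u : ℝ => (if i ∈ range (e ∘ g) then u ^ r else 1) := by
      split_ifs <;> fun_prop
    have h2 : Measurable fun u : ℝ => (if i ∈ range e then u ^ (-k) else 1) := by
      split_ifs <;> fun_prop
    simp only [φ]
    fun_prop
  -- Three kinds of index. In the range of e ∘ g the exponent is d/2 + r - k = 0, and the total mass
  -- of h is 1; elsewhere in the range of e it is d/2 - k, the exponent of (S4); outside it is d/2,
  -- as in (S3).
  have hφint : ∀ g i, ∫⁻ u in Ioi (0 : ℝ), φ g i u < ∞ := by
    intro g i
    by_cases h1 : i ∈ range e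
    · by_cases h2 : i ∈ range (e ∘ g)
      · have : ∀ u ∈ Ioi (0 : ℝ), φ g i u = h u := by
          intro u hu
          have hu0 : (0 : ℝ) < u := hu
          simp only [φ, if_pos h1, if_pos h2]
          rw [mul_right_comm, ← ENNReal.ofReal_mul (by positivity), ← Real.rpow_add hu0,
            ← Real.rpow_add hu0, show (d : ℝ) / 2 + (r + -k) = 0 by rw [hr]; ring,
            Real.rpow_zero, ENNReal.ofReal_one, one_mul]
        rw [setLIntegral_congr_fun measurableSet_Ioi this, hh.lintegral_eq_one]
        exact ENNReal.one_lt_top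
      · have : ∀ u ∈ Ioi (0 : ℝ), φ g i u =
            ENNReal.ofReal (u ^ (-((n : ℝ) - p + 2 * a - 2 * d - 1) / 2)) * (h u : ℝ≥0∞) := by
          intro u hu
          have hu0 : (0 : ℝ) < u := hu
          simp only [φ, if_pos h1, if_neg h2, one_mul]
          rw [mul_right_comm, ← ENNReal.ofReal_mul (by positivity), ← Real.rpow_add hu0]
          congr 3
          rw [hk]
          ring
        rw [setLIntegral_congr_fun measurableSet_Ioi this]
        exact S4
    · have h2 : i ∉ range (e ∘ g) := fun ⟨j, hj⟩ => h1 ⟨g j, hj⟩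
      simpa only [φ, if_neg h1, if_neg h2, one_mul, ENNReal.ofReal_one, mul_one] using S3
  have hprod : ∀ g ∈ T, ∀ z : Fin n → ℝ, (∀ i, 0 < z i) → mixWeight h d z *
      ENNReal.ofReal ((∏ j, z (e (g j)) ^ r) * ∏ l, z (e l) ^ (-k)) = ∏ i, φ g i (z i) := by
    intro g hg z hz
    have h1 : ∏ j, z (e (g j)) ^ r = ∏ i, (if i ∈ range (e ∘ g) then z i ^ r else 1) :=
      Fintype.prod_of_injective (e ∘ g) (he.comp (hT g hg)) _ _ (fun i hi => if_neg hi)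
        fun j => by simp
    have h2 : ∏ l, z (e l) ^ (-k) = ∏ i, (if i ∈ range e then z i ^ (-k) else 1) :=
      Fintype.prod_of_injective e he _ _ (fun i hi => if_neg hi) fun j => by simp
    rw [h1, h2, ← Finset.prod_mul_distrib, ENNReal.ofReal_prod_of_nonneg, mixWeight,
      ← Finset.prod_mul_distrib]
    intro i _
    have := (hz i).le
    split_ifs <;> positivity
  have hle : ∀ z ∈ {z : Fin n → ℝ | ∀ i, 0 < z i}, mixWeight h d z *
      ∫⁻ s, jointWeight X y (n / 2 + a) z s ∂stateMeasure p d ≤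
        C * ∑ g ∈ T, ∏ i, φ g i (z i) := by
    intro z hz
    calc _ ≤ mixWeight h d z * (C * ∑ g ∈ T, ENNReal.ofReal ((∏ j, z (e (g j)) ^ r) *
          ∏ l, z (e l) ^ (-k))) := by
          gcongr
          exact hbound z hz
      _ = C * ∑ g ∈ T, mixWeight h d z * ENNReal.ofReal ((∏ j, z (e (g j)) ^ r) *
          ∏ l, z (e l) ^ (-k)) := by rw [mul_left_comm, Finset.mul_sum]
      _ = _ := by
          congr 1
          exact Finset.sum_congr rfl fun g hg => hprod g hg z hz
  refine (setLIntegral_mono' (measurableSet_posOrthant n) hle).trans_lt ?_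
  rw [lintegral_const_mul' _ _ hC, lintegral_finsetSum]
  · refine ENNReal.mul_lt_top hC.lt_top (ENNReal.sum_lt_top.2 fun g _ => ?_)
    rw [lintegral_posOrthant_prod (hφ g)]
    exact ENNReal.prod_lt_top fun i _ => hφint g i
  · exact fun g _ => Finset.measurable_fun_prod _ fun i _ => (hφ g i).comp (measurable_pi_apply i)

end Propriety

end

end DataAug

namespace DataAug

noncomputable section

/-! ### Abstract data augmentation chains. -/

section DataAugmentation

variable {S Z : Type*} [MeasurableSpace S] [MeasurableSpace Z] {ν : Measure S} {τ : Measure Z}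
  [SFinite ν] [SFinite τ]

/-- A data augmentation chain with latent weight `W`, joint weight `J` and conditional normalizing
constants `N`, `G` gives a positive trace-class operator, provided that the trace of its transition
density is finite. -/
theorem exists_dataAugmentation_operator {J : Z → S → ℝ≥0∞} {W N : Z → ℝ≥0∞} {G : S → ℝ≥0∞}
    {k : S → S → ℝ≥0∞} {C c I : ℝ≥0∞}
    (hJ : Measurable fun q : Z × S => J q.1 q.2) (hW : Measurable W) (hN : Measurable N)
    (hG : Measurable G) (hc : c ≠ ∞) (hI0 : I ≠ 0) (hI : I ≠ ∞)
    (hNz : ∀ᵐ z ∂τ, N z ≠ 0 ∧ N z ≠ ∞ ∧ ∫⁻ s, J z s ∂ν = C * N z)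
    (hGs : ∀ᵐ s ∂ν, G s ≠ 0 ∧ G s ≠ ∞ ∧ (∀ z, J z s ≠ ∞) ∧ ∫⁻ z, W z * J z s ∂τ = G s)
    (hGI : ∫⁻ s, G s ∂ν = I) (hC : C ≠ ∞)
    (hk : ∀ᵐ s ∂ν, ∀ᵐ s' ∂ν, k s' s = ∫⁻ z, c * (N z)⁻¹ * J z s' * (W z * J z s / G s) ∂τ)
    (htrace : ∫⁻ z, (N z)⁻¹ * ∫⁻ s, (W z * J z s / G s) * J z s ∂ν ∂τ < ∞) :
    ∃ K : L20 (ν.withDensity fun s => G s / I) →L[ℝ] L20 (ν.withDensity fun s => G s / I),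
      (∀ f : L20 (ν.withDensity fun s => G s / I), ∀ᵐ s ∂ν.withDensity fun s => G s / I,
        Integrable (fun s' => (f : Lp ℝ 2 (ν.withDensity fun s => G s / I)) s' *
          (k s' s).toReal) ν ∧
        (K f : Lp ℝ 2 (ν.withDensity fun s => G s / I)) s =
          ∫ s', (f : Lp ℝ 2 (ν.withDensity fun s => G s / I)) s' * (k s' s).toReal ∂ν) ∧
      IsPositiveTraceClass K := by
  have hGIm : Measurable fun s => G s / I := hG.div_const I
  set P := ν.withDensity fun s => G s / I with hP
  -- Chosen so that (G s' / I) ∫ κ(s', z) κ(s, z) dQ(z) is the transition density, with κ = J / G.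
  set q : Z → ℝ≥0∞ := fun z => c * I * W z * (N z)⁻¹ with hq
  have hqm : Measurable q := (hW.const_mul _).mul hN.inv
  set Q := τ.withDensity q with hQ
  have hPν : P ≪ ν := withDensity_absolutelyContinuous _ _
  have hQτ : Q ≪ τ := withDensity_absolutelyContinuous _ _
  have hPfin : IsFiniteMeasure P := by
    refine isFiniteMeasure_withDensity ?_
    simp only [div_eq_mul_inv]
    rw [lintegral_mul_const _ hG, hGI]
    exact ENNReal.mul_ne_top hI (ENNReal.inv_ne_top.2 hI0)
  have hII : I⁻¹ * I = 1 := ENNReal.inv_mul_cancel hI0 hI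
  have hGG : ∀ s, G s ≠ 0 → G s ≠ ∞ → (G s)⁻¹ * G s = 1 := fun s h0 h1 =>
    ENNReal.inv_mul_cancel h0 h1
  have hJs : ∀ s, Measurable fun z => J z s := fun s => hJ.comp measurable_prodMk_right
  have hJz : ∀ z, Measurable fun s => J z s := fun z => hJ.comp measurable_prodMk_left
  set κ : S × Z → ℝ := fun p => (J p.2 p.1 / G p.1).toReal with hκdef
  have hκ' : Measurable fun p : S × Z => J p.2 p.1 / G p.1 :=
    (hJ.comp measurable_swap).div (hG.comp measurable_fst)
  have hκm : Measurable κ := hκ'.ennreal_toReal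
  have hdivtop : ∀ z s, J z s ≠ ∞ → G s ≠ 0 → J z s / G s ≠ ∞ := fun z s h1 h2 =>
    ENNReal.div_ne_top h1 h2
  have hκ : MemLp κ 2 (P.prod Q) := by
    rw [memLp_two_iff_integrable_sq hκm.aestronglyMeasurable]
    refine ⟨(hκm.pow_const 2).aestronglyMeasurable, ?_⟩
    have h1 : ∀ p : S × Z, ‖κ p ^ 2‖ₑ ≤ (J p.2 p.1 / G p.1) ^ 2 := by
      intro p
      rw [Real.enorm_of_nonneg (sq_nonneg _), ENNReal.ofReal_pow ENNReal.toReal_nonneg]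
      gcongr
      exact ENNReal.ofReal_toReal_le
    refine (lintegral_mono h1).trans_lt ?_
    rw [lintegral_prod_symm _ (hκ'.pow_const 2).aemeasurable]
    rw [hQ, lintegral_withDensity_eq_lintegral_mul _ hqm (Measurable.lintegral_prod_left'
      (hκ'.pow_const 2))]
    -- The squared L² norm of κ is c times the integral in `htrace`.
    have h2 : ∀ z, (q * fun z => ∫⁻ s, (J z s / G s) ^ 2 ∂P) z =
        c * ((N z)⁻¹ * ∫⁻ s, (W z * J z s / G s) * J z s ∂ν) := by
      intro z
      have hm : Measurable fun s => (J z s / G s) ^ 2 := ((hJz z).div hG).pow_const 2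
      have hm2 : Measurable fun s => (W z * J z s / G s) * J z s :=
        (((hJz z).const_mul _).div hG).mul (hJz z)
      rw [Pi.mul_apply, hP, lintegral_withDensity_eq_lintegral_mul _ hGIm hm,
        ← lintegral_const_mul _ (hGIm.mul hm), ← lintegral_const_mul _ hm2,
        ← lintegral_const_mul _ (hm2.const_mul _)]
      refine lintegral_congr_ae ?_
      filter_upwards [hGs] with s hs
      simp only [Pi.mul_apply, hq, div_eq_mul_inv]
      calc _ = c * ((N z)⁻¹ * (W z * J z s * (G s)⁻¹ * J z s)) * (I⁻¹ * I) * ((G s)⁻¹ * G s) := by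
            ring
        _ = _ := by rw [hII, hGG s hs.1 hs.2.1, mul_one, mul_one]
    rw [lintegral_congr h2, lintegral_const_mul' _ _ hc]
    exact ENNReal.mul_lt_top hc.lt_top htrace
  have hinner : ∀ᵐ z ∂τ, ∫ s', κ (s', z) ∂P = (C * N z / I).toReal := by
    filter_upwards [hNz] with z hz
    have hm : Measurable fun s => J z s / G s := (hJz z).div hG
    simp only [hκdef]
    rw [integral_toReal hm.aemeasurable]
    · congr 1
      rw [hP, lintegral_withDensity_eq_lintegral_mul _ hGIm hm, ← hz.2.2,
        div_eq_mul_inv, ← lintegral_mul_const _ (hJz z)]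
      refine lintegral_congr_ae ?_
      filter_upwards [hGs] with s hs
      simp only [Pi.mul_apply, div_eq_mul_inv]
      calc _ = J z s * I⁻¹ * ((G s)⁻¹ * G s) := by ring
        _ = _ := by rw [hGG s hs.1 hs.2.1, mul_one]
    · refine hPν.ae_le ?_
      filter_upwards [hGs] with s hs
      exact (hdivtop z s (hs.2.2.1 z) hs.1).lt_top
  -- Only constancy in s matters, so the normalizing constants c and C need not be compared.
  have hmass : ∀ᵐ s ∂P, ∫ z, κ (s, z) * ∫ s', κ (s', z) ∂P ∂Q = (c * C).toReal := by
    refine hPν.ae_le ?_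
    filter_upwards [hGs] with s hs
    have h1 : ∫ z, κ (s, z) * ∫ s', κ (s', z) ∂P ∂Q =
        ∫ z, (J z s / G s * (C * N z / I)).toReal ∂Q := by
      refine integral_congr_ae (hQτ.ae_le ?_)
      filter_upwards [hinner] with z hz
      rw [hz, ENNReal.toReal_mul]
    have hm : Measurable fun z => J z s / G s * (C * N z / I) :=
      ((hJs s).div_const _).mul ((hN.const_mul _).div_const _)
    rw [h1, integral_toReal hm.aemeasurable]
    · congr 1
      rw [hQ, lintegral_withDensity_eq_lintegral_mul _ hqm hm]
      have h2 : c * C * (∫⁻ z, W z * J z s ∂τ) * (G s)⁻¹ = c * C := by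
        rw [hs.2.2.2, mul_assoc, mul_comm (G s), hGG s hs.1 hs.2.1, mul_one]
      have hm' : Measurable fun z => W z * J z s := hW.mul (hJs s)
      rw [← h2, ← lintegral_const_mul _ hm', ← lintegral_mul_const _ (hm'.const_mul _)]
      refine lintegral_congr_ae ?_
      filter_upwards [hNz] with z hz
      simp only [Pi.mul_apply, hq, div_eq_mul_inv]
      calc _ = c * C * (W z * J z s) * (G s)⁻¹ * (I⁻¹ * I) * ((N z)⁻¹ * N z) := by ring
        _ = _ := by rw [hII, ENNReal.inv_mul_cancel hz.1 hz.2.1, mul_one, mul_one]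
    · refine hQτ.ae_le ?_
      filter_upwards [hNz] with z hz
      exact (ENNReal.mul_ne_top (hdivtop z s (hs.2.2.1 z) hs.1)
        (ENNReal.div_ne_top (ENNReal.mul_ne_top hC hz.2.1) hI0)).lt_top
  obtain ⟨K, hK, hpos⟩ := exists_positiveTraceClass_of_kernel hκ _ hmass
  refine ⟨K, fun f => ?_, hpos⟩
  have hkernel : ∀ᵐ s ∂ν, ∀ᵐ s' ∂ν, ∀ x : ℝ,
      (G s' / I).toReal • (x * ∫ z, κ (s', z) * κ (s, z) ∂Q) = x * (k s' s).toReal := by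
    filter_upwards [hGs, hk] with s hs hks
    filter_upwards [hGs, hks] with s' hs' hks' x
    have h1 : ∫ z, κ (s', z) * κ (s, z) ∂Q = (I / G s' * k s' s).toReal := by
      have h2 : ∀ z, κ (s', z) * κ (s, z) = (J z s' / G s' * (J z s / G s)).toReal := fun z =>
        ENNReal.toReal_mul.symm
      have hm : Measurable fun z => J z s' / G s' * (J z s / G s) :=
        ((hJs s').div_const _).mul ((hJs s).div_const _)
      simp only [h2]
      rw [integral_toReal hm.aemeasurable]
      · congr 1
        rw [hQ, lintegral_withDensity_eq_lintegral_mul _ hqm hm, hks',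
          ← lintegral_const_mul' _ _ (ENNReal.div_ne_top hI hs'.1)]
        refine lintegral_congr fun z => ?_
        simp only [Pi.mul_apply, hq, div_eq_mul_inv]
        ring
      · exact Filter.Eventually.of_forall fun z =>
          (ENNReal.mul_ne_top (hdivtop z s' (hs'.2.2.1 z) hs'.1)
            (hdivtop z s (hs.2.2.1 z) hs.1)).lt_top
    rw [h1, smul_eq_mul, mul_left_comm, ← ENNReal.toReal_mul]
    congr 2
    simp only [div_eq_mul_inv]
    calc _ = (I⁻¹ * I) * ((G s')⁻¹ * G s') * k s' s := by ring
      _ = _ := by rw [hII, hGG s' hs'.1 hs'.2.1, one_mul, one_mul]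
  have hfin : ∀ᵐ s ∂ν, G s / I < ∞ := by
    filter_upwards [hGs] with s hs
    exact (ENNReal.div_ne_top hs.2.1 hI0).lt_top
  filter_upwards [hK f, hPν.ae_le hkernel] with s hs hks
  have hcongr : (fun s' => (G s' / I).toReal • ((f : Lp ℝ 2 P) s' *
      ∫ z, κ (s', z) * κ (s, z) ∂Q)) =ᵐ[ν] fun s' => (f : Lp ℝ 2 P) s' * (k s' s).toReal := by
    filter_upwards [hks] with s' hs'
    exact hs' _
  constructor
  · exact ((integrable_withDensity_iff_integrable_smul' hGIm hfin).1 hs.1).congr hcongr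
  · rw [hs.2, ← integral_congr_ae hcongr]
    exact integral_withDensity_eq_integral_toReal_smul hGIm hfin _

end DataAugmentation

end

end DataAug

namespace DataAug

noncomputable section

/-! ### The posterior, its latent weights and the trace. -/

section Posterior

open Matrix

variable {n p d : ℕ} {h : ℝ → ℝ≥0} (a : ℝ) {X : Matrix (Fin n) (Fin p) ℝ}
  {y : Matrix (Fin n) (Fin d) ℝ}

theorem mixWeight_mul_jointWeight (t : ℝ) {s : State p d} (hs : s.scale.PosDef) (z : Fin n → ℝ) :
    mixWeight h d z * jointWeight X y t z s = ENNReal.ofReal (s.scale.det ^ (-t)) *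
      ∏ i, (ENNReal.ofReal (z i ^ ((d : ℝ) / 2) * Real.exp (-(resid X y s i * z i) / 2)) *
        (h (z i) : ℝ≥0∞)) := by
  rw [jointWeight, ENNReal.ofReal_mul (Real.rpow_nonneg hs.det_pos.le _), mul_left_comm]
  congr 1
  rw [Finset.mul_sum, Real.exp_sum, ENNReal.ofReal_prod_of_nonneg fun i _ => (Real.exp_pos _).le,
    mixWeight, ← Finset.prod_mul_distrib]
  refine Finset.prod_congr rfl fun i _ => ?_
  rw [mul_right_comm, ← ENNReal.ofReal_mul' (Real.exp_pos _).le]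
  congr 4
  ring

variable (h X y) in
/-- The unnormalized marginal density of `(β, Σ)`. -/
def jointMass (t : ℝ) (s : State p d) : ℝ≥0∞ :=
  ∫⁻ z in {z : Fin n → ℝ | ∀ i, 0 < z i}, mixWeight h d z * jointWeight X y t z s

theorem jointMass_eq (hh : Measurable h) (t : ℝ) {s : State p d} (hs : s.scale.PosDef) :
    jointMass h X y t s = ENNReal.ofReal (s.scale.det ^ (-t)) *
      ∏ i, laplaceMix h d (resid X y s i) := by
  simp only [jointMass, mixWeight_mul_jointWeight t hs]
  rw [lintegral_const_mul' _ _ ENNReal.ofReal_ne_top, lintegral_posOrthant_prod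
    (φ := fun i u => ENNReal.ofReal (u ^ ((d : ℝ) / 2) *
      Real.exp (-(resid X y s i * u) / 2)) * (h u : ℝ≥0∞)) fun i => by fun_prop]
  rfl

theorem measurable_mixWeight_mul_jointWeight (hh : Measurable h) (t : ℝ) :
    Measurable fun q : (Fin n → ℝ) × State p d => mixWeight h d q.1 * jointWeight X y t q.1 q.2 :=
  ((measurable_mixWeight hh).comp measurable_fst).mul (measurable_jointWeight X y t)

theorem measurable_jointMass (hh : Measurable h) (t : ℝ) : Measurable (jointMass h X y t) :=
  Measurable.lintegral_prod_left' (measurable_mixWeight_mul_jointWeight hh t)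

/-- Bayes' rule for the latent weights; the power of det Σ cancels, so t is arbitrary. -/
theorem condLatent_eq (hh : Measurable h) (hpos : ∃ ε > (0 : ℝ), ∀ u ∈ Ioo 0 ε, 0 < h u) (t : ℝ)
    {s : State p d} (hs : s.scale.PosDef) (z : Fin n → ℝ) :
    condLatent h X y z s = mixWeight h d z * jointWeight X y t z s / jointMass h X y t s := by
  have h0 : ENNReal.ofReal (s.scale.det ^ (-t)) ≠ 0 :=
    (ENNReal.ofReal_pos.2 (Real.rpow_pos_of_pos hs.det_pos _)).ne'
  rw [mixWeight_mul_jointWeight t hs, jointMass_eq hh t hs,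
    ENNReal.mul_div_mul_left _ _ h0 ENNReal.ofReal_ne_top, condLatent]
  simp only [psi_eq, div_eq_mul_inv]
  rw [Finset.prod_mul_distrib, ENNReal.prod_inv_distrib]
  intro i _ j _ _
  exact Or.inl (laplaceMix_pos hh hpos (resid_nonneg X y hs i)).ne'

/-- The factor `(2π)^{-nd/2}` of the likelihood. -/
def likelihoodConst (n d : ℕ) : ℝ≥0∞ :=
  ENNReal.ofReal (((2 * Real.pi) ^ ((d : ℝ) / 2))⁻¹) ^ n

theorem likelihoodConst_ne_zero (n d : ℕ) : likelihoodConst n d ≠ 0 :=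
  pow_ne_zero _ (ENNReal.ofReal_pos.2 (by positivity)).ne'

theorem likelihoodConst_ne_top (n d : ℕ) : likelihoodConst n d ≠ ∞ :=
  ENNReal.pow_ne_top ENNReal.ofReal_ne_top

/-- The n factors |Σ|^{-1/2} and the prior |Σ|^{-a} account for the exponent n/2 + a. -/
theorem likelihood_mul_prior (hh : Measurable h) {s : State p d} (hs : s.scale.PosDef) :
    likelihood h X y s * prior a s =
      likelihoodConst n d * jointMass h X y (n / 2 + a) s := by
  have hd := hs.det_pos
  have h1 : ∀ i : Fin n, ∫⁻ u in Ioi (0 : ℝ), ENNReal.ofReal (u ^ ((d : ℝ) / 2) /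
      ((2 * Real.pi) ^ ((d : ℝ) / 2) * s.scale.det ^ (1 / 2 : ℝ)) *
        Real.exp (-(u / 2) * resid X y s i)) * (h u : ℝ≥0∞) =
      ENNReal.ofReal (((2 * Real.pi) ^ ((d : ℝ) / 2))⁻¹) *
        ENNReal.ofReal (s.scale.det ^ (-(1 / 2) : ℝ)) * laplaceMix h d (resid X y s i) := by
    intro i
    rw [laplaceMix, ← lintegral_const_mul' _ _
      (ENNReal.mul_ne_top ENNReal.ofReal_ne_top ENNReal.ofReal_ne_top)]
    refine lintegral_congr fun u => ?_
    rw [← mul_assoc, ← ENNReal.ofReal_mul (by positivity), ← ENNReal.ofReal_mul (by positivity),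
      Real.rpow_neg hd.le]
    congr 2
    rw [show -(u / 2) * resid X y s i = -(resid X y s i * u) / 2 by ring]
    field_simp
  rw [likelihood]
  simp only [h1]
  rw [Finset.prod_mul_distrib, Finset.prod_const, Finset.card_univ, Fintype.card_fin,
    jointMass_eq hh _ hs, prior, mul_pow, likelihoodConst]
  have h2 : ENNReal.ofReal (s.scale.det ^ (-((n : ℝ) / 2 + a))) =
      ENNReal.ofReal (s.scale.det ^ (-(1 / 2) : ℝ)) ^ n * ENNReal.ofReal (s.scale.det ^ (-a)) := by
    rw [← ENNReal.ofReal_pow (Real.rpow_nonneg hd.le _), ← ENNReal.ofReal_mul (by positivity),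
      ← Real.rpow_natCast, ← Real.rpow_mul hd.le, ← Real.rpow_add hd]
    congr 2
    ring
  rw [h2]
  ring

theorem lintegral_jointMass (hh : Measurable h) (t : ℝ) :
    ∫⁻ s, jointMass h X y t s ∂stateMeasure p d =
      ∫⁻ z in {z : Fin n → ℝ | ∀ i, 0 < z i},
        mixWeight h d z * ∫⁻ s, jointWeight X y t z s ∂stateMeasure p d := by
  have hswap := lintegral_lintegral_swap (μ := volume.restrict {z : Fin n → ℝ | ∀ i, 0 < z i})
    (ν := stateMeasure p d) (f := fun z s => mixWeight h d z * jointWeight X y t z s)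
    (measurable_mixWeight_mul_jointWeight hh t).aemeasurable
  refine hswap.symm.trans ?_
  refine lintegral_congr fun z => ?_
  rw [lintegral_const_mul _
    (Measurable.of_uncurry_left (f := jointWeight X y t) (measurable_jointWeight X y t))]

/-- The inner integral over s is nonzero for every positive z, so a zero total would force W = 0
almost everywhere, although ∫ W is a product of positive integrals. -/
theorem lintegral_jointMass_ne_zero (hh : Measurable h)
    (hpos : ∃ ε > (0 : ℝ), ∀ u ∈ Ioo 0 ε, 0 < h u) (S1 : (fromCols X y).rank = p + d) {t : ℝ}
    (ht : (p : ℝ) / 2 + d < t) : ∫⁻ s, jointMass h X y t s ∂stateMeasure p d ≠ 0 := by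
  obtain ⟨C, hC0, -, hC⟩ := exists_lintegral_jointWeight X y t ht
  intro h0
  have hm : Measurable fun z => mixWeight h d z * ∫⁻ s, jointWeight X y t z s ∂stateMeasure p d :=
    (measurable_mixWeight hh).mul (Measurable.lintegral_prod_right' (measurable_jointWeight X y t))
  rw [lintegral_jointMass hh, lintegral_eq_zero_iff hm] at h0
  have h1 : ∫⁻ z in {z : Fin n → ℝ | ∀ i, 0 < z i}, mixWeight h d z = 0 := by
    rw [lintegral_eq_zero_iff (measurable_mixWeight hh)]
    filter_upwards [h0, ae_restrict_mem (measurableSet_posOrthant n)] with z hz hz'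
    have hW := posDef_crossMat_of_rank S1 hz'
    have hne : ∫⁻ s, jointWeight X y t z s ∂stateMeasure p d ≠ 0 := by
      rw [hC z (posDef_crossMat_left hW) (posDef_residMat hW)]
      exact mul_ne_zero hC0 (normFactor_ne_zero (posDef_crossMat_left hW) (posDef_residMat hW))
    exact (mul_eq_zero.1 hz).resolve_right hne
  have h2 := lintegral_posOrthant_prod (n := n)
    (φ := fun _ u => ENNReal.ofReal (u ^ ((d : ℝ) / 2)) * (h u : ℝ≥0∞)) fun i => by fun_prop
  have h3 : ∫⁻ u in Ioi (0 : ℝ), ENNReal.ofReal (u ^ ((d : ℝ) / 2)) * (h u : ℝ≥0∞) ≠ 0 :=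
    ((mixMass_pos hh hpos one_pos).trans_le (lintegral_mono_set Ioo_subset_Ioi_self)).ne'
  refine Finset.prod_ne_zero_iff.2 (fun i _ => h3) (h2.symm.trans h1)

/-- Finiteness of the trace of the transition density. -/
theorem lintegral_trace_lt_top (hh : Measurable h)
    (hpos : ∃ ε > (0 : ℝ), ∀ u ∈ Ioo 0 ε, 0 < h u) (S1 : (fromCols X y).rank = p + d)
    (S3 : ∫⁻ u in Ioi (0 : ℝ), ENNReal.ofReal (u ^ ((d : ℝ) / 2)) * (h u : ℝ≥0∞) < ∞)
    {ζ η : ℝ} (hζ : ζ ∈ Ioo (1 : ℝ) 2) (hη : 0 < η)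
    (hint : ∫⁻ u in Ioo (0 : ℝ) η, mixRatio h d ζ u < ∞) {t : ℝ} (ht : (p : ℝ) / 2 + d < t) :
    ∫⁻ z in {z : Fin n → ℝ | ∀ i, 0 < z i}, (normFactor X y t z)⁻¹ *
      ∫⁻ s, (mixWeight h d z * jointWeight X y t z s / jointMass h X y t s) *
        jointWeight X y t z s ∂stateMeasure p d < ∞ := by
  obtain ⟨C, -, hCtop, hC⟩ := exists_lintegral_jointWeight X y t ht
  have hζ2 : 0 < 2 - ζ := by linarith [hζ.2]
  obtain ⟨b, hb, hbz⟩ := normFactor_smul (X := X) (y := y) t hζ2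
  have hle : ∀ z ∈ {z : Fin n → ℝ | ∀ i, 0 < z i}, (normFactor X y t z)⁻¹ *
      ∫⁻ s, (mixWeight h d z * jointWeight X y t z s / jointMass h X y t s) *
        jointWeight X y t z s ∂stateMeasure p d ≤ C * b * ∏ i, mixRatio h d ζ (z i) := by
    intro z hz
    have hW := posDef_crossMat_of_rank S1 hz
    have hX := posDef_crossMat_left hW
    have hS := posDef_residMat hW
    have hz' : ∀ i, 0 < ((2 - ζ) • z) i := fun i => mul_pos hζ2 (hz i)
    have hW' := posDef_crossMat_of_rank S1 hz'
    -- The growth exp((ζ - 1)/2 · ∑ zᵢ rᵢ) from `psi_le` meets exp(-½ ∑ zᵢ rᵢ) in the remaining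
    -- joint weight, whose argument becomes (2 - ζ)z.
    have h1 : ∀ᵐ s ∂stateMeasure p d,
        (mixWeight h d z * jointWeight X y t z s / jointMass h X y t s) * jointWeight X y t z s ≤
          (∏ i, mixRatio h d ζ (z i)) * jointWeight X y t ((2 - ζ) • z) s := by
      filter_upwards [ae_stateMeasure_posDef p d] with s hs
      rw [← condLatent_eq hh hpos t hs, condLatent]
      have h2 : ∏ i, psi h d (z i) (resid X y s i) ≤ (∏ i, mixRatio h d ζ (z i)) *
          ENNReal.ofReal (Real.exp ((ζ - 1) / 2 * ∑ i, z i * resid X y s i)) := by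
        rw [Finset.mul_sum, Real.exp_sum,
          ENNReal.ofReal_prod_of_nonneg fun i _ => (Real.exp_pos _).le, ← Finset.prod_mul_distrib]
        exact Finset.prod_le_prod' fun i _ => psi_le (hz i) (resid_nonneg X y hs i)
      refine (mul_le_mul_left h2 _).trans (le_of_eq ?_)
      rw [mul_assoc, jointWeight, jointWeight, ← ENNReal.ofReal_mul (Real.exp_pos _).le,
        mul_left_comm (Real.exp _), ← Real.exp_add]
      congr 4
      simp only [Pi.smul_apply, smul_eq_mul, mul_assoc, ← Finset.mul_sum]
      ring
    calc _ ≤ (normFactor X y t z)⁻¹ * ∫⁻ s, (∏ i, mixRatio h d ζ (z i)) *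
          jointWeight X y t ((2 - ζ) • z) s ∂stateMeasure p d := by
          gcongr (normFactor X y t z)⁻¹ * ?_
          exact lintegral_mono_ae h1
      _ = (normFactor X y t z)⁻¹ * ((∏ i, mixRatio h d ζ (z i)) *
          (C * (b * normFactor X y t z))) := by
          rw [lintegral_const_mul _ (Measurable.of_uncurry_left (f := jointWeight X y t)
            (measurable_jointWeight X y t)), hC _ (posDef_crossMat_left hW') (posDef_residMat hW')]
          rw [← hbz z hX hS]
          rfl
      _ = C * b * (∏ i, mixRatio h d ζ (z i)) *
          ((normFactor X y t z)⁻¹ * normFactor X y t z) := by ring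
      _ = _ := by
          rw [ENNReal.inv_mul_cancel (normFactor_ne_zero hX hS) ENNReal.ofReal_ne_top, mul_one]
  refine (setLIntegral_mono' (measurableSet_posOrthant n) hle).trans_lt ?_
  rw [lintegral_const_mul' _ _ (ENNReal.mul_ne_top hCtop hb),
    lintegral_posOrthant_prod fun _ => measurable_mixRatio hh (by linarith [hζ.1])]
  exact ENNReal.mul_lt_top (ENNReal.mul_ne_top hCtop hb).lt_top (ENNReal.prod_lt_top fun i _ =>
    lintegral_mixRatio_lt_top hh hpos S3 hζ.1 hη hint)

theorem posterior_eq (hh : Measurable h) : posterior h a X y =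
    (stateMeasure p d).withDensity fun s => jointMass h X y (n / 2 + a) s /
      ∫⁻ s, jointMass h X y (n / 2 + a) s ∂stateMeasure p d := by
  have h1 : ∀ᵐ s ∂stateMeasure p d, likelihood h X y s * prior a s =
      likelihoodConst n d * jointMass h X y (n / 2 + a) s :=
    (ae_stateMeasure_posDef p d).mono fun s hs => likelihood_mul_prior a hh hs
  refine withDensity_congr_ae ?_
  filter_upwards [h1] with s hs
  rw [posteriorDensity, marginal, lintegral_congr_ae h1, hs,
    lintegral_const_mul' _ _ (likelihoodConst_ne_top n d),
    ENNReal.mul_div_mul_left _ _ (likelihoodConst_ne_zero n d) (likelihoodConst_ne_top n d)]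

end Posterior

end

end DataAug

open DataAug

theorem lemma2 {n p d : ℕ} (a : ℝ)
    (X : Matrix (Fin n) (Fin p) ℝ) (y : Matrix (Fin n) (Fin d) ℝ)
    (h : ℝ → ℝ≥0) (hh : DataAug.IsMixingDensity h)
    (S1 : (Matrix.fromCols X y).rank = p + d)
    (S2 : (n : ℝ) > p + 2 * d - 2 * a)
    (S3 : ∫⁻ u in Ioi (0 : ℝ), ENNReal.ofReal (u ^ ((d : ℝ) / 2)) * (h u : ℝ≥0∞) < ∞)
    (S4 : ∫⁻ u in Ioi (0 : ℝ),
      ENNReal.ofReal (u ^ (-((n : ℝ) - p + 2 * a - 2 * d - 1) / 2)) * (h u : ℝ≥0∞) < ∞)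
    (hpos : ∃ ε > (0 : ℝ), ∀ u ∈ Ioo 0 ε, 0 < h u)
    (hint : ∃ ζ ∈ Ioo (1 : ℝ) 2, ∃ η > (0 : ℝ),
      ∫⁻ u in Ioo (0 : ℝ) η,
        ENNReal.ofReal (u ^ ((d : ℝ) / 2)) * (h u : ℝ≥0∞) /
          ∫⁻ v in Ioo (0 : ℝ) (ζ * u), ENNReal.ofReal (v ^ ((d : ℝ) / 2)) * (h v : ℝ≥0∞) < ∞) :
    IsProbabilityMeasure (DataAug.posterior h a X y) ∧
    ∃ K : DataAug.L20 (DataAug.posterior h a X y) →L[ℝ] DataAug.L20 (DataAug.posterior h a X y),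
      DataAug.IsMarkovOperator h a X y K ∧ DataAug.IsPositiveTraceClass K := by
  obtain ⟨ζ, hζ, η, hη, hint⟩ := hint
  have hhm := hh.measurable
  -- (S2) is exactly the condition under which the inverse Wishart integral in Σ is available.
  have ht : (p : ℝ) / 2 + d < n / 2 + a := by linarith
  set t : ℝ := (n : ℝ) / 2 + a with ht_def
  have hI0 := lintegral_jointMass_ne_zero (n := n) hhm hpos S1 ht
  have hI : ∫⁻ s, jointMass h X y t s ∂stateMeasure p d ≠ ∞ := by
    rw [lintegral_jointMass hhm]
    exact (lintegral_mixWeight_mul_lt_top hh a S1 S2 S3 S4).ne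
  have hpost := posterior_eq (n := n) (X := X) (y := y) a hhm
  rw [← ht_def] at hpost
  have hGm := measurable_jointMass (X := X) (y := y) hhm t
  obtain ⟨C, -, hCtop, hC⟩ := exists_lintegral_jointWeight X y t ht
  obtain ⟨c, -, hctop, hc⟩ := exists_condBeta_mul_condScale X y a S2
  constructor
  · rw [hpost]
    constructor
    rw [withDensity_apply _ MeasurableSet.univ, Measure.restrict_univ]
    simp only [div_eq_mul_inv]
    rw [lintegral_mul_const _ hGm, ENNReal.mul_inv_cancel hI0 hI]
  · unfold IsMarkovOperator
    rw [hpost]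
    refine exists_dataAugmentation_operator (τ := volume.restrict {z : Fin n → ℝ | ∀ i, 0 < z i})
      (J := jointWeight X y t) (W := mixWeight h d) (N := normFactor X y t)
      (k := transDensity h a X y) (C := C) (c := c) (measurable_jointWeight X y t)
      (measurable_mixWeight hhm) (measurable_normFactor X y t) hGm hctop hI0 hI ?_ ?_ rfl hCtop ?_
      (lintegral_trace_lt_top hhm hpos S1 S3 hζ hη hint ht)
    · filter_upwards [ae_restrict_mem (measurableSet_posOrthant n)] with z hz
      have hW := posDef_crossMat_of_rank S1 hz
      exact ⟨normFactor_ne_zero (posDef_crossMat_left hW) (posDef_residMat hW),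
        ENNReal.ofReal_ne_top, hC z (posDef_crossMat_left hW) (posDef_residMat hW)⟩
    · filter_upwards [ae_stateMeasure_posDef p d] with s hs
      refine ⟨?_, ?_, fun z => ENNReal.ofReal_ne_top, rfl⟩
      · rw [jointMass_eq hhm t hs]
        exact mul_ne_zero (ENNReal.ofReal_pos.2 (Real.rpow_pos_of_pos hs.det_pos _)).ne'
          (Finset.prod_ne_zero_iff.2 fun i _ =>
            (laplaceMix_pos hhm hpos (resid_nonneg X y hs i)).ne')
      · rw [jointMass_eq hhm t hs]
        exact ENNReal.mul_ne_top ENNReal.ofReal_ne_top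
          (ENNReal.prod_ne_top fun i _ => laplaceMix_ne_top S3 (resid_nonneg X y hs i))
    · filter_upwards [ae_stateMeasure_posDef p d] with s hs
      filter_upwards [ae_stateMeasure_posDef p d] with s' hs'
      refine setLIntegral_congr_fun (measurableSet_posOrthant n) fun z hz => ?_
      have hW := posDef_crossMat_of_rank S1 hz
      rw [hc z (posDef_crossMat_left hW) (posDef_residMat hW) s' hs',
        condLatent_eq hhm hpos t hs]
      rfl
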